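/- \textbf{Setting.} Let $m_1,\dots,m_r\ge 1$, $n=m_1+\dots+m_r$, and let $U\subseteq\mathbb R^n$ be open, with coordinates $u^{i(\alpha)}$, $1\le\alpha\le r$, $1\le i\le m_\alpha$; write $\partial_{i(\alpha)}=\partial/\partial u^{i(\alpha)}$. Let $c^{i(\alpha)}_{j(\beta)k(\gamma)}=\delta^\alpha_\beta\delta^\alpha_\gamma\delta^i_{j+k-1}$ be the structure constants of a product $\circ$ on vector fields, with unit $e^{i(\alpha)}=\delta^i_1$ (canonical coordinates of a regular F-manifold). Let $X$ be a smooth vector field on $U$ with $X^{1(\alpha)}\ne X^{1(\beta)}$ everywhere for $\alpha\neq\beta$, and $X^{2(\alpha)}\neq 0$ everywhere whenever $m_\alpha\ge2$. The system $u_t=X\circ u_x$ is \emph{of Darboux--Tsarev type} if (a) $\partial_{k(\sigma)}X^{i(\alpha)}=0$ whenever $k>i$; (b) the smooth torsionless connection $\nabla$, with Christoffel symbols $\Gamma$, determined by $\nabla e=0$ and $d_\nabla(X\circ)=0$ (that is, $\nabla_jV^i_k=\nabla_kV^i_j$ for $V^i_k=c^i_{ks}X^s$) satisfies $R^s_{lmi}c^j_{ks}+R^s_{lik}c^j_{ms}+R^s_{lkm}c^j_{is}=0$,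 where $R^j_{lmi}=\partial_m\Gamma^j_{il}-\partial_i\Gamma^j_{ml}+\Gamma^j_{ms}\Gamma^s_{il}-\Gamma^j_{is}\Gamma^s_{ml}$. \textbf{The system.} For unknown functions $\theta_{i(\alpha)}$ consider the following equations. All indices of derivatives $\partial_{j(\beta)}$ and of left-hand sides lie in their blocks, and symbols $\Gamma$, $\theta$ carrying a position outside its block are read as $0$. \begin{align*} &\partial_{j(\beta)}\theta_{i(\alpha)}=0 &&\text{if } i+j\ge m_\alpha+2,\ \beta\neq\alpha,\ \text{ or } i+j\geq m_\alpha+3,\ \beta=\alpha;\\ &\partial_{2(\alpha)}\theta_{m_\alpha(\alpha)}=\frac{2}{m_\alpha}\Big(\sum_{k=2}^{m_\alpha}\Gamma^{k(\alpha)}_{2(\alpha)k(\alpha)}\Big)\theta_{m_\alpha(\alpha)} &&\text{if } m_\alpha\ge 2;\\ &\partial_{j(\alpha)}\theta_{i(\alpha)}=\partial_{(j-1)(\alpha)}\theta_{(i+1)(\alpha)}+\partial_{2(\alpha)}\theta_{(i+j-2)(\alpha)}-\partial_{1(\alpha)}\theta_{(i+j-1)(\alpha)}\\ &\qquad+2\sum_{s=j-1}^{m_\alpha-i+1}\Big(\Gamma^{(s-j+1)(\alpha)}_{1(\alpha)1(\alpha)}-\Gamma^{s(\alpha)}_{2(\alpha)(j-1)(\alpha)}\Big)\theta_{(i+s-1)(\alpha)}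 &&\text{if } 3\le j\le m_\alpha-i+2;\\ &\partial_{j(\beta)}\theta_{i(\alpha)}=2\sum_{s=j}^{m_\alpha-i+1}\Gamma^{s(\alpha)}_{j(\beta)1(\alpha)}\theta_{(s+i-1)(\alpha)} &&\text{if } j\le m_\alpha-i+1,\ \beta\ne\alpha. \end{align*} It prescribes each $\partial_{j(\beta)}\theta_{i(\alpha)}$ by one equation, except $\partial_{1(\alpha)}\theta_{i(\alpha)}$ and, for $i<m_\alpha$, $\partial_{2(\alpha)}\theta_{i(\alpha)}$, which are free. \textbf{Proposition.} If $u_t=X\circ u_x$ is of Darboux--Tsarev type on $U$, then this system is compatible: for every $i(\alpha)$ and all $j(\beta)$, $k(\gamma)$ such that both $\partial_{j(\beta)}\theta_{i(\alpha)}$ and $\partial_{k(\gamma)}\theta_{i(\alpha)}$ are prescribed, $$\big(\partial_{j(\beta)}\partial_{k(\gamma)}-\partial_{k(\gamma)}\partial_{j(\beta)}\big)\theta_{i(\alpha)}=0$$ on solutions of the system, in the formal sense of cross-differentiation. Precisely: let $u\in U$, and let real numbers $v_I$, $p_{JI}$, $q_{KJI}$ (standing for $\theta_I$, $\partial_J\theta_I$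 and $\partial_K(\partial_J\theta_I)$ at $u$; $I,J,K$ double indices) satisfy the equations of the system at $u$, the equations obtained from them by differentiating once with respect to each coordinate (by the chain rule, with $\partial_K\theta_I=p_{KI}$ and $\partial_K(\partial_J\theta_I)=q_{KJI}$), and $q_{KJI}=q_{JKI}$ whenever $\partial_J\theta_I$ and $\partial_K\theta_I$ are not both prescribed. Then $q_{JKI}-q_{KJI}=0$ also whenever both are prescribed. -/

import Mathlib

open scoped BigOperators ContDiff

noncomputable section

namespace DT

/-- The double indices `i(α)`, with `α` one of `r` blocks and `1 ≤ i ≤ m α`.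
A pair `⟨α, i⟩` carries the one-based position `i` inside the block `α`. -/
abbrev BIdx {r : ℕ} (m : Fin r → ℕ) : Type := Σ a : Fin r, ↥(Finset.Icc 1 (m a))

/-- The coordinate space `ℝⁿ`, `n = m 1 + ⋯ + m r`, with canonical coordinates `u^{i(α)}`. -/
abbrev Pt {r : ℕ} (m : Fin r → ℕ) : Type := BIdx m → ℝ

variable {r : ℕ} {m : Fin r → ℕ}

/-- The partial derivative `∂_{i(α)} f`. -/
def pd (I : BIdx m) (f : Pt m → ℝ) (u : Pt m) : ℝ := fderiv ℝ f u (Pi.single I 1)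

/-- The entry of position `i` in block `a` of a family indexed by double indices, for an arbitrary
natural number `i`; entries whose position is outside `1, …, m a` are zero by convention. -/
def comp (f : BIdx m → ℝ) (a : Fin r) (i : ℕ) : ℝ :=
  if h : i ∈ Finset.Icc 1 (m a) then f ⟨a, i, h⟩ else 0

/-! ### The product and the connection in canonical coordinates -/

/-- The structure constants `c^{i(α)}_{j(β)k(γ)} = δ^α_β δ^α_γ δ^i_{j+k-1}`. -/
def sc (I J K : BIdx m) : ℝ :=
  if J.1 = I.1 ∧ K.1 = I.1 ∧ (I.2 : ℕ) + 1 = (J.2 : ℕ) + (K.2 : ℕ) then 1 else 0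

/-- The unit vector field, `e^{i(α)} = δ^i_1`. -/
def unit (I : BIdx m) : ℝ := if (I.2 : ℕ) = 1 then 1 else 0

/-- The operator of multiplication by `X`: `V^i_k = c^i_{ks} X^s`. -/
def mulOp (X : BIdx m → Pt m → ℝ) (I K : BIdx m) (u : Pt m) : ℝ := ∑ S, sc I K S * X S u

/-- `∇_j Y^i = ∂_j Y^i + Γ^i_{js} Y^s`; here `Γ I J K` stands for `Γ^I_{JK}`. -/
def covVec (Γ : BIdx m → BIdx m → BIdx m → Pt m → ℝ) (Y : BIdx m → Pt m → ℝ)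
    (J I : BIdx m) (u : Pt m) : ℝ :=
  pd J (Y I) u + ∑ S, Γ I J S u * Y S u

/-- `∇_j V^i_k = ∂_j V^i_k + Γ^i_{js} V^s_k - Γ^s_{jk} V^i_s`. -/
def covEnd (Γ : BIdx m → BIdx m → BIdx m → Pt m → ℝ) (V : BIdx m → BIdx m → Pt m → ℝ)
    (J I K : BIdx m) (u : Pt m) : ℝ :=
  pd J (V I K) u + ∑ S, Γ I J S u * V S K u - ∑ S, Γ S J K u * V I S u

/-- The curvature
`R^j_{lki} = ∂_k Γ^j_{il} - ∂_i Γ^j_{kl} + Γ^j_{ks} Γ^s_{il} - Γ^j_{is} Γ^s_{kl}`. -/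
def curv (Γ : BIdx m → BIdx m → BIdx m → Pt m → ℝ) (J L K I : BIdx m) (u : Pt m) : ℝ :=
  pd K (Γ J I L) u - pd I (Γ J K L) u
    + ∑ S, (Γ J K S u * Γ S I L u - Γ J I S u * Γ S K L u)

/-- The hydrodynamic system `u_t = X ∘ u_x` is of Darboux–Tsarev type on `U`, and `Γ` are the
Christoffel symbols of the torsionless connection that it determines. -/
structure IsDarbouxTsarev (U : Set (Pt m)) (X : BIdx m → Pt m → ℝ)
    (Γ : BIdx m → BIdx m → BIdx m → Pt m → ℝ) : Prop where
  smooth_X : ∀ I, ContDiffOn ℝ ∞ (X I) U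
  /-- `X^{1(α)} ≠ X^{1(β)}` for `α ≠ β` -/
  distinct : ∀ u ∈ U, ∀ a b : Fin r, a ≠ b →
    comp (fun I => X I u) a 1 ≠ comp (fun I => X I u) b 1
  /-- `X^{2(α)} ≠ 0` for each block of size at least two -/
  nonzero : ∀ u ∈ U, ∀ a : Fin r, 2 ≤ m a → comp (fun I => X I u) a 2 ≠ 0
  /-- `X^{i(α)}` depends only on the coordinates `u^{k(σ)}` with `k ≤ i` -/
  depends : ∀ u ∈ U, ∀ I K : BIdx m, (I.2 : ℕ) < (K.2 : ℕ) → pd K (X I) u = 0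
  smooth_Γ : ∀ I J K, ContDiffOn ℝ ∞ (Γ I J K) U
  /-- the connection is torsionless -/
  torsionless : ∀ u ∈ U, ∀ I J K, Γ I J K u = Γ I K J u
  /-- `∇ e = 0` -/
  flat_unit : ∀ u ∈ U, ∀ J I, covVec Γ (fun S _ => unit S) J I u = 0
  /-- `d_∇ (X ∘) = 0` -/
  closed : ∀ u ∈ U, ∀ I J K, covEnd Γ (mulOp X) J I K u - covEnd Γ (mulOp X) K I J u = 0
  /-- `R^s_{lki} c^j_{ps} + R^s_{lip} c^j_{ks} + R^s_{lpk} c^j_{is} = 0` -/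
  curvature : ∀ u ∈ U, ∀ J L K I P,
    ∑ S, (curv Γ S L K I u * sc J P S + curv Γ S L I P u * sc J K S
      + curv Γ S L P K u * sc J I S) = 0

/-! ### Solved first-order systems and their compatibility -/

/-- A function `F(u, θ, ∂θ)` of the point `u`, the values `v I = θ_I` and the first derivatives
`p J I = ∂_J θ_I`. -/
abbrev JetFun (m : Fin r → ℕ) : Type := Pt m → (BIdx m → ℝ) → (BIdx m → BIdx m → ℝ) → ℝ

/-- The total derivative `D_K F = ∂F/∂u^K + p_{K I} ∂F/∂θ_I + q_{K J I} ∂F/∂p_{J I}`, a function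
of `u`, `v`, `p` and of the second derivatives `q K J I = ∂_K (∂_J θ_I)`. -/
def totalDeriv (F : JetFun m) (K : BIdx m) (u : Pt m) (v : BIdx m → ℝ)
    (p : BIdx m → BIdx m → ℝ) (q : BIdx m → BIdx m → BIdx m → ℝ) : ℝ :=
  deriv (fun t : ℝ => F (u + t • Pi.single K 1) (fun I => v I + t * p K I)
    (fun J I => p J I + t * q K J I)) 0

/-- A formal solution at the point `u`, up to second order, of the system
`∂_J θ_I = F J I (u, θ, ∂θ)`, one equation for each pair `(J, I)` with `D J I`. It consists of
values `v I` for `θ_I`, `p J I` for `∂_J θ_I` and `q K J I` for the iterated derivative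
`∂_K (∂_J θ_I)`. They satisfy the equations and the equations differentiated once in every
direction. The two orders of an iterated derivative of `θ_I` are identified unless the system
prescribes both of the first derivatives involved: in that last case each order is computed
from its own equation, and it is the content of compatibility that the results agree. -/
structure IsFormalSolution (D : BIdx m → BIdx m → Prop) (F : BIdx m → BIdx m → JetFun m)
    (u : Pt m) (v : BIdx m → ℝ) (p : BIdx m → BIdx m → ℝ)
    (q : BIdx m → BIdx m → BIdx m → ℝ) : Prop where
  eqn : ∀ J I, D J I → p J I = F J I u v p
  deriv_eqn : ∀ K J I, D J I → q K J I = totalDeriv (F J I) K u v p q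
  symm : ∀ K J I, ¬ (D J I ∧ D K I) → q K J I = q J K I

/-- Compatibility of the system `∂_J θ_I = F J I (u, θ, ∂θ)`, `D J I`, on `U`: the mixed
derivatives `(∂_J ∂_K - ∂_K ∂_J) θ_I`, computed from the system for all `J`, `K` for which
`∂_J θ_I` and `∂_K θ_I` are prescribed by it, vanish on its solutions, identically in the values
of the unknowns and of the derivatives that the system leaves free. -/
def IsCompatible (U : Set (Pt m)) (D : BIdx m → BIdx m → Prop)
    (F : BIdx m → BIdx m → JetFun m) : Prop :=
  ∀ u ∈ U, ∀ v p q, IsFormalSolution D F u v p q →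
    ∀ J K I, D J I → D K I → q J K I - q K J I = 0

/-! ### The system for `θ` -/

/-- `Γ^{i(a)}_{j(b)k(c)}` at `u`, for natural numbers `i`, `j`, `k`; zero if a position is outside
its block. -/
def chr (Γ : BIdx m → BIdx m → BIdx m → Pt m → ℝ) (u : Pt m) (a : Fin r) (i : ℕ)
    (b : Fin r) (j : ℕ) (c : Fin r) (k : ℕ) : ℝ :=
  comp (fun I => comp (fun J => comp (fun K => Γ I J K u) c k) b j) a i

/-- `∂_{j(b)} θ_{i(a)}` read off from the first derivatives `p`, for natural numbers `j`, `i`; zero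
if a position is outside its block. -/
def dθ (p : BIdx m → BIdx m → ℝ) (b : Fin r) (j : ℕ) (a : Fin r) (i : ℕ) : ℝ :=
  comp (fun J => comp (fun I => p J I) a i) b j

/-- The derivatives `∂_{j(β)} θ_{i(α)}` prescribed by the system: all of them except
`∂_{1(α)} θ_{i(α)}` and, for `i < m_α`, `∂_{2(α)} θ_{i(α)}`. -/
def Prescribed (J I : BIdx m) : Prop :=
  J.1 ≠ I.1 ∨ 3 ≤ (J.2 : ℕ) ∨ ((J.2 : ℕ) = 2 ∧ (I.2 : ℕ) = m I.1)

/-- The right-hand side of the equation for `∂_{j(β)} θ_{i(α)}`, where `J = j(β)`, `I = i(α)`. -/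
def rhs (Γ : BIdx m → BIdx m → BIdx m → Pt m → ℝ) (J I : BIdx m) : JetFun m :=
  fun u v p =>
    let b := J.1
    let j : ℕ := J.2
    let a := I.1
    let i : ℕ := I.2
    if b = a then
      if m a + 3 ≤ i + j then 0
      else if j = 2 then
        -- here `i = m_α`
        2 / (m a : ℝ) * (∑ k ∈ Finset.Icc 2 (m a), chr Γ u a k a 2 a k) * comp v a (m a)
      else
        -- here `3 ≤ j ≤ m_α - i + 2`
        dθ p a (j - 1) a (i + 1) + dθ p a 2 a (i + j - 2) - dθ p a 1 a (i + j - 1)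
          + 2 * ∑ s ∈ Finset.Icc (j - 1) (m a + 1 - i),
              (chr Γ u a (s + 1 - j) a 1 a 1 - chr Γ u a s a 2 a (j - 1)) * comp v a (i + s - 1)
    else
      if m a + 2 ≤ i + j then 0
      else
        2 * ∑ s ∈ Finset.Icc j (m a + 1 - i), chr Γ u a s b j a 1 * comp v a (s + i - 1)

end DT

end

/-! At a point, vector fields take values in the algebra `A = ∏ ℝ[ε]/(ε^m_α)`, and the connection is
a symmetric bilinear map `H` on `A` with `H(x, 1) = 0`. Eliminating the derivatives of `X` from
`d_∇(X∘) = 0` gives the cocycle identity `H(x, yz) - y H(x, z) = H(y, xz) - x H(y, z)` for `z = X`.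
The conditions on `X^{1(α)}` and `X^{2(α)}` make `X` a generator of `A`, so the identity holds for
every `z` (`IsCocycle.of_generator`). Its coefficients are constant, hence all derivatives of the
connection satisfy it too.

A covector in block `α` becomes an element `Θ` of that block on which `ε` acts as an index shift.
Let `e` be the idempotent of the block, `h` the normalized block component of `H`, and `F(n)` the
sums with `h(ε^a, ε^b) = F(a+b) - ε^a F(b) - ε^b F(a)`. With `P_n = ∂_{n+1} Θ` the system reads `∂_J
Θ = 2 H(J, e) Θ` across blocks and `P_n = n ε^(n-1) P_1 - (n-1) ε^n P_0 - 2 F(n) Θ` for `0 ≤ n ≤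
m_α` inside (`IsSolutionWithSource.transverse`, `IsSolutionWithSource.blk_eq`). Here `P_{m_α} = 0`,
and the case `n = m_α` encodes the equation for `∂_2 θ_{m_α}`.

Cross-differentiation then needs three consequences of the curvature condition: symmetry of the
transverse derivatives (`IsFlatJet.deriv_transverse`), a coboundary formula for the derivative of
`h` across blocks (`IsFlatJet.blockPart_deriv`), and flatness within a block
(`IsFlatJet.blockPart_flat`), used through `cobound_deriv_symm`. They reduce every commutator inside
the block to those with `∂_1`, which vanish by freeness, and those with `∂_2`. The latter can only
be nonzero at position `m_α`, and the closed form at `n = m_α` kills that entry. -/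

open scoped BigOperators ContDiff

noncomputable section

namespace DT

/-! ### Symmetric cocycles on a commutative algebra -/

section Cocycle

variable {A : Type*} [CommRing A] [Algebra ℝ A]

/-- `H(x, yz) - y H(x, z)` is symmetric in `x` and `y`. -/
def IsCocycle (H : A →ₗ[ℝ] A →ₗ[ℝ] A) : Prop :=
  ∀ x y z, H x (y * z) - y * H x z = H y (x * z) - x * H y z

/-- The cocycle condition propagates from `z = 1` and `z = ξ` to any algebra generated by `ξ`. -/
theorem IsCocycle.of_generator {H : A →ₗ[ℝ] A →ₗ[ℝ] A} (hs : ∀ x y, H x y = H y x)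
    (h1 : ∀ x, H x 1 = 0) {ξ : A}
    (hξ : ∀ x y, H x (y * ξ) - y * H x ξ = H y (x * ξ) - x * H y ξ)
    (gen : ∀ C : Submodule ℝ A, 1 ∈ C → (∀ c ∈ C, ξ * c ∈ C) → C = ⊤) : IsCocycle H := by
  let C : Submodule ℝ A :=
    { carrier := {z | ∀ x y, H x (y * z) - y * H x z = H y (x * z) - x * H y z}
      zero_mem' := by intro x y; simp
      add_mem' := by
        intro z w hz hw x y
        simp only [mul_add, map_add]
        linear_combination hz x y + hw x y
      smul_mem' := by
        intro t z hz x y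
        simp only [mul_smul_comm, map_smul]
        rw [← smul_sub, hz x y, smul_sub] }
  have hC : C = ⊤ := by
    apply gen
    · intro x y
      simp [h1, hs x y]
    · intro c hc x y
      -- The condition at `ξ` trades `H x (y * ξ * c)` for `H (x * ξ) (y * c)`, which the assumption
      -- on `c` turns into `H y (x * ξ * c)`. The other two instances cancel the remainders.
      have e1 := hξ x (y * c)
      have e2 := hξ x c
      have e3 := hc (x * ξ) y
      have e4 := hc y ξ
      rw [hs (y * c) ξ, show y * c * ξ = y * (ξ * c) by ring, hs (y * c) (x * ξ)] at e1
      rw [show c * ξ = ξ * c by ring, hs c (x * ξ), hs c ξ] at e2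
      rw [show x * ξ * c = x * (ξ * c) by ring] at e3
      linear_combination e1 - y * e2 + e3 + x * e4
  intro x y z
  have : z ∈ C := hC ▸ Submodule.mem_top
  exact this x y

/-- The sums `∑_{k<n} ε^{n-1-k} H(ε, ε^k)`. -/
def cobound (H : A →ₗ[ℝ] A →ₗ[ℝ] A) (ε : A) : ℕ → A
  | 0 => 0
  | n + 1 => ε * cobound H ε n + H ε (ε ^ n)

theorem cobound_zero_left (ε : A) (n : ℕ) : cobound (0 : A →ₗ[ℝ] A →ₗ[ℝ] A) ε n = 0 := by
  induction n with
  | zero => rfl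
  | succ n ih => simp [cobound, ih]

/-- On powers of `ε` a normalized cocycle is the coboundary of `ε^n ↦ cobound H ε n`. -/
theorem IsCocycle.apply_pow {H : A →ₗ[ℝ] A →ₗ[ℝ] A} (hH : IsCocycle H)
    (hs : ∀ x y, H x y = H y x) (h1 : ∀ x, H x 1 = 0) (ε : A) (a b : ℕ) :
    H (ε ^ a) (ε ^ b)
      = cobound H ε (a + b) - ε ^ a * cobound H ε b - ε ^ b * cobound H ε a := by
  induction a generalizing b with
  | zero => simp [hs 1, h1, cobound]
  | succ a ih =>
    have e1 := hH (ε ^ b) (ε ^ a) ε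
    have e2 := ih (b + 1)
    rw [← pow_succ, ← pow_succ, hs (ε ^ b) ε, hs (ε ^ a) ε, hs (ε ^ b)] at e1
    rw [show a + (b + 1) = a + 1 + b by ring] at e2
    simp only [cobound] at e2 ⊢
    rw [show a + 1 + b = a + b + 1 by ring] at e2 ⊢
    simp only [cobound] at e2 ⊢
    linear_combination e1 + e2

/-- The sums `∑_{k<n} ε^{n-1-k} w k`. -/
def geomSum (ε : A) (w : ℕ → A) : ℕ → A
  | 0 => 0
  | n + 1 => ε * geomSum ε w n + w n

/-- The compatibility of the operators attached to the powers of `ε` for a flat family of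
normalized cocycles: the expression below is symmetric in `a` and `b`. -/
theorem cobound_deriv_symm {H : A →ₗ[ℝ] A →ₗ[ℝ] A} {dH : A → A →ₗ[ℝ] A →ₗ[ℝ] A}
    (hH : IsCocycle H) (hs : ∀ x y, H x y = H y x) (h1 : ∀ x, H x 1 = 0)
    (dhH : ∀ k, IsCocycle (dH k)) (dhs : ∀ k x y, dH k x y = dH k y x)
    (dh1 : ∀ k x, dH k x 1 = 0)
    (flat : ∀ k i l, dH k i l - k * dH 1 i l - (dH i k l - i * dH 1 k l)
      + H k (H i l) - H i (H k l) = 0) (ε : A) (a b : ℕ) :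
    cobound (dH (ε ^ a)) ε b - a * ε ^ (a - 1) * cobound (dH ε) ε b
        + (a - 1) * ε ^ a * cobound (dH 1) ε b
      = cobound (dH (ε ^ b)) ε a - b * ε ^ (b - 1) * cobound (dH ε) ε a
        + (b - 1) * ε ^ b * cobound (dH 1) ε a := by
  set F := cobound H ε with hF
  set D : ℕ → ℕ → A := fun a b => cobound (dH (ε ^ a)) ε b - ε ^ a * cobound (dH 1) ε b with hD
  set G : ℕ → A := fun b => cobound (dH ε) ε b - ε * cobound (dH 1) ε b with hG
  set V := geomSum ε G with hV
  set W := geomSum ε (fun n => H ε (F n)) with hW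
  -- `q` sums the quadratic curvature terms along the recursion in `b`, and it is visibly symmetric
  -- in `a` and `b`.
  set q : ℕ → ℕ → A := fun a b => H (ε ^ a) (F b) + H (ε ^ b) (F a) + F a * F b - W (a + b)
    + ε ^ b * W a + ε ^ a * W b with hq
  have q0 : ∀ a, q a 0 = 0 := by
    intro a
    simp [hq, hF, cobound, hs 1, h1, hW, geomSum]
  have qsucc : ∀ a b, q a (b + 1) - ε * q a b
      = H (ε ^ a) (H ε (ε ^ b)) - H ε (H (ε ^ a) (ε ^ b)) := by
    intro a b
    have e1 := hH (ε ^ a) ε (F b)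
    have e2 := hH (F a) ε (ε ^ b)
    rw [← pow_succ', hs (F a), hs (F a), mul_comm (F a) (ε ^ b)] at e2
    have e3 := hH.apply_pow hs h1 ε a b
    have e4 : F (b + 1) = ε * F b + H ε (ε ^ b) := rfl
    have e5 : ∀ n, W (n + 1) = ε * W n + H ε (F n) := fun n => rfl
    simp only [hq]
    rw [e3, ← add_assoc, e5, e5, e4]
    simp only [map_add, map_sub]
    linear_combination e1 + e2
  have Dsucc : ∀ a b, D a (b + 1) - ε * D a b
      = G (a + b) - ε ^ a * G b - ε ^ b * G a - (q a (b + 1) - ε * q a b) := by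
    intro a b
    have e0 := flat (ε ^ a) ε (ε ^ b)
    have e1 := (dhH ε).apply_pow (dhs ε) (dh1 ε) ε a b
    have e2 := (dhH 1).apply_pow (dhs 1) (dh1 1) ε a b
    rw [e1, e2] at e0
    rw [qsucc]
    simp only [hD, hG, cobound]
    linear_combination e0
  -- Flatness at `(ε^a, ε, ε^b)` is a recursion in `b`; summing it gives a right side symmetric in
  -- `a` and `b`. Symmetry of the left side is the assertion.
  have main : ∀ a b, D a b + b * ε ^ (b - 1) * G a
      = V (a + b) - ε ^ a * V b - ε ^ b * V a - q a b := by
    intro a b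
    induction b with
    | zero => simp [q0, hD, cobound, hV, geomSum]
    | succ b ih =>
      have e5 : ∀ n, V (n + 1) = ε * V n + G n := fun n => rfl
      have e6 : (b : A) * ε ^ (b - 1) * ε = b * ε ^ b := by
        cases b with
        | zero => simp
        | succ b => rw [Nat.add_sub_cancel, pow_succ]; ring
      rw [← add_assoc, e5, e5, Nat.add_sub_cancel]
      push_cast
      linear_combination Dsucc a b + ε * ih - G a * e6
  have e6 : ∀ b : ℕ, (b : A) * ε ^ (b - 1) * ε = b * ε ^ b := by
    intro b
    cases b with
    | zero => simp
    | succ b => rw [Nat.add_sub_cancel, pow_succ]; ring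
  have m1 := main a b
  have m2 := main b a
  have hqs : q a b = q b a := by
    simp only [hq]
    rw [add_comm b a]; ring
  rw [hqs] at m1
  rw [add_comm b a] at m2
  simp only [hD, hG] at m1 m2
  linear_combination m1 - m2 + cobound (dH 1) ε a * e6 b - cobound (dH 1) ε b * e6 a

end Cocycle

/-! ### The components of a connection along an idempotent -/

section Block

variable {A : Type*} [CommRing A] [Algebra ℝ A]

/-- The component of `H` along the idempotent `e`, normalized to vanish on `1`. -/
def blockPart (e : A) (H : A →ₗ[ℝ] A →ₗ[ℝ] A) : A →ₗ[ℝ] A →ₗ[ℝ] A :=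
  LinearMap.mk₂ ℝ (fun x y => e * H (e * x) (e * y) - x * y * (e * H e e))
    (by intro x x' y; simp only [mul_add, map_add, LinearMap.add_apply]; ring)
    (by
      intro c x y
      simp only [mul_smul_comm, map_smul, LinearMap.smul_apply, smul_mul_assoc, smul_sub])
    (by intro x y y'; simp only [mul_add, map_add]; ring)
    (by
      intro c x y
      simp only [mul_smul_comm, map_smul, smul_mul_assoc, smul_sub])

theorem blockPart_apply (e : A) (H : A →ₗ[ℝ] A →ₗ[ℝ] A) (x y : A) :
    blockPart e H x y = e * H (e * x) (e * y) - x * y * (e * H e e) := rfl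

/-- A symmetric cocycle vanishing on the unit. -/
structure IsNormalized (H : A →ₗ[ℝ] A →ₗ[ℝ] A) : Prop where
  symm : ∀ x y, H x y = H y x
  unit : ∀ x, H x 1 = 0
  cocycle : IsCocycle H

variable {e : A} {H : A →ₗ[ℝ] A →ₗ[ℝ] A}

/-- The cocycle identity with third argument `e`, multiplied by `e`: the terms containing `x * e`
and `e * x` drop out. A direction outside the block thus acts on the block by multiplication. The
next two lemmas come from the same kind of substitution. -/
theorem IsNormalized.apply_idem_mul (h : IsNormalized H) {x y : A}
    (hx : e * x = 0) (hy : e * y = y) : e * H x y = y * (e * H x e) := by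
  have e1 := h.cocycle x y e
  rw [show y * e = y by rw [mul_comm, hy], show x * e = 0 by rw [mul_comm, hx], map_zero] at e1
  linear_combination e * e1 - H y e * hx

theorem IsNormalized.apply_idem_right (h : IsNormalized H) (he : e * e = e) {x : A}
    (hx : e * x = x) : e * H x e = x * (e * H e e) := by
  have e1 := h.cocycle x e e
  rw [he, h.symm e (x * e), show x * e = x by rw [mul_comm, hx]] at e1
  linear_combination -e1 - H e e * hx

theorem IsNormalized.apply_of_idem_mul_eq_zero (h : IsNormalized H) (he : e * e = e) {x : A}
    (y : A) (hx : e * x = 0) : e * H x y = y * (e * H x e) - e * H (x * y) e := by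
  have e1 := h.cocycle x e y
  have e2 := h.apply_idem_mul hx (y := e * y) (by rw [← mul_assoc, he])
  rw [h.symm e (x * y)] at e1
  linear_combination (-e) * e1 + e2 + H e y * hx - H x y * he + y * H x e * he

/-- The correction `x * y * (e * H e e)` satisfies the cocycle identity trivially, both sides being
zero, and it is what makes the component vanish on `1`. -/
theorem IsNormalized.blockPart (h : IsNormalized H) (he : e * e = e) :
    IsNormalized (blockPart e H) where
  symm x y := by
    rw [blockPart_apply, blockPart_apply, h.symm (e * x), mul_comm x y]
  unit x := by
    have := h.apply_idem_right he (x := e * x) (by rw [← mul_assoc, he])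
    rw [blockPart_apply, mul_one, mul_one, this]
    linear_combination x * H e e * he
  cocycle := by
    intro x y z
    have e1 := h.cocycle (e * x) (e * y) (e * z)
    rw [show e * y * (e * z) = e * (y * z) by linear_combination y * z * he,
      show e * x * (e * z) = e * (x * z) by linear_combination x * z * he] at e1
    simp only [blockPart_apply]
    linear_combination e * e1 + (y * H (e * x) (e * z) - x * H (e * y) (e * z)) * he

/-- The curvature of a connection with constant structure in terms of its derivative. -/
def curvOf (Γ : A →ₗ[ℝ] A →ₗ[ℝ] A) (dΓ : A →ₗ[ℝ] A →ₗ[ℝ] A →ₗ[ℝ] A) (x y z : A) : A :=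
  dΓ x y z - dΓ y x z + Γ x (Γ y z) - Γ y (Γ x z)

/-- The algebraic properties at one point of the connection of a Darboux–Tsarev system and of its
first derivatives. -/
structure IsFlatJet (Γ : A →ₗ[ℝ] A →ₗ[ℝ] A) (dΓ : A →ₗ[ℝ] A →ₗ[ℝ] A →ₗ[ℝ] A) : Prop where
  norm : IsNormalized Γ
  dnorm : ∀ x, IsNormalized (dΓ x)
  curv : ∀ x y z w,
    curvOf Γ dΓ x y z * w + curvOf Γ dΓ y w z * x + curvOf Γ dΓ w x z * y = 0

variable {Γ : A →ₗ[ℝ] A →ₗ[ℝ] A} {dΓ : A →ₗ[ℝ] A →ₗ[ℝ] A →ₗ[ℝ] A}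

/-- In the curvature identity at `(x, y, e, e)`, multiplication by `e` leaves only the curvature in
the directions `x`, `y`. Its quadratic terms cancel because the cocycle identity gives `x * Γ y e =
y * Γ x e`. -/
theorem IsFlatJet.deriv_transverse (h : IsFlatJet Γ dΓ) (he : e * e = e) {x y : A}
    (hx : e * x = 0) (hy : e * y = 0) : e * dΓ x y e = e * dΓ y x e := by
  have e1 := h.curv x y e e
  have e2 := h.norm.apply_of_idem_mul_eq_zero he (Γ y e) hx
  have e3 := h.norm.apply_of_idem_mul_eq_zero he (Γ x e) hy
  have e4 := h.norm.cocycle x y e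
  rw [mul_comm y, mul_comm x, hx, hy, map_zero, map_zero] at e4
  rw [show x * Γ y e = y * Γ x e by linear_combination e4] at e2
  simp only [curvOf] at e1
  linear_combination e * e1 - (dΓ x y e - dΓ y x e + Γ x (Γ y e) - Γ y (Γ x e)) * he
    - (dΓ y e e - dΓ e y e + Γ y (Γ e e) - Γ e (Γ y e)) * hx
    - (dΓ e x e - dΓ x e e + Γ e (Γ x e) - Γ x (Γ e e)) * hy - e2 + e3

/-- The curvature identity with fourth argument `e` gives `e R(x, J) y = x e R(e, J) y`, since the
third term carries the factor `e * J = 0`. The left side is `e R(x, J) y` written out, with the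
contributions of the other blocks kept as `Γ ((1 - e) * _) e`. -/
theorem IsFlatJet.curv_mixed (h : IsFlatJet Γ dΓ) (he : e * e = e) {J x y : A}
    (hJ : e * J = 0) (hx : e * x = x) (hy : e * y = y) :
    y * (e * dΓ x J e) - e * dΓ J x y + e * Γ x (y * (e * Γ J e))
        + x * (e * Γ ((1 - e) * Γ J y) e) - e * Γ x y * (e * Γ J e)
        - e * Γ ((1 - e) * Γ J (x * y)) e
      = x * y * (e * dΓ e J e - e * dΓ J e e) := by
  have aux : ∀ x y, e * x = x → e * y = y → e * curvOf Γ dΓ x J y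
      = y * (e * dΓ x J e) - e * dΓ J x y + e * Γ x (y * (e * Γ J e))
        + x * (e * Γ ((1 - e) * Γ J y) e) - e * Γ x y * (e * Γ J e)
        - e * Γ ((1 - e) * Γ J (x * y)) e := by
    intro x y hx hy
    have e1 := (h.dnorm x).apply_idem_mul hJ hy
    have e2 := h.norm.apply_of_idem_mul_eq_zero he (Γ x y) hJ
    have e3 := h.norm.apply_idem_mul hJ hy
    have e4 : Γ x (Γ J y) = Γ x (e * Γ J y) + Γ x ((1 - e) * Γ J y) := by
      rw [← map_add]; congr 1; ring
    rw [e3] at e4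
    have e5 : e * ((1 - e) * Γ J y) = 0 := by linear_combination -(Γ J y) * he
    have e6 := h.norm.apply_idem_mul e5 hx
    rw [h.norm.symm] at e6
    have e7 := h.norm.cocycle x J y
    rw [show J * y = 0 by linear_combination y * hJ - J * hy, map_zero] at e7
    have e8 : J * Γ x y = -((1 - e) * Γ J (x * y)) := by
      have : e * (J * Γ x y) = 0 := by linear_combination Γ x y * hJ
      linear_combination this - (1 - e) * e7 - Γ J y * hx
    rw [e8] at e2
    simp only [map_neg, LinearMap.neg_apply] at e2
    simp only [curvOf]
    linear_combination e1 - e2 + e * e4 + e6 + Γ x y * Γ J e * he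
  have e1 := h.curv x J y e
  have e2 := aux x y hx hy
  have e3 := aux e y he hy
  have e4 := (h.dnorm J).apply_idem_right he hy
  have e5 := h.norm.apply_idem_right he hy
  have e6 := h.norm.apply_idem_right he
    (x := y * (e * Γ J e)) (by linear_combination y * Γ J e * he)
  have e7 : curvOf Γ dΓ J e y = - curvOf Γ dΓ e J y := by simp only [curvOf]; ring
  rw [e7] at e1
  rw [(h.dnorm J).symm] at e4
  rw [h.norm.symm] at e5 e6
  rw [hy] at e3
  linear_combination -e2 + e * e1 - curvOf Γ dΓ x J y * he - curvOf Γ dΓ e x y * hJ + x * e3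
    - x * e4 + x * e6 - x * (e * Γ J e) * e5
    + x * Γ ((1 - e) * Γ J y) e * he

/-- The derivative across blocks of the normalized component. -/
theorem IsFlatJet.blockPart_deriv (h : IsFlatJet Γ dΓ) (he : e * e = e) {J : A}
    (hJ : e * J = 0) (x y : A) :
    -blockPart e (dΓ J) x y = e * dΓ (e * (x * y)) J e - x * (e * dΓ (e * y) J e)
      - y * (e * dΓ (e * x) J e) + x * y * (e * dΓ e J e) := by
  have key : ∀ x y, e * x = x → e * y = y →
      -(e * dΓ J x y - x * y * (e * dΓ J e e)) = e * dΓ (x * y) J e - x * (e * dΓ y J e)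
      - y * (e * dΓ x J e) + x * y * (e * dΓ e J e) := by
    intro x y hx hy
    have hxy : e * (x * y) = x * y := by linear_combination y * hx
    -- In the combination `c1 - c2 + x * c3` the contributions `Γ ((1 - e) * Γ J _) e` of the other
    -- blocks cancel.
    have c1 := h.curv_mixed he hJ hx hy
    have c2 := h.curv_mixed he hJ hxy he
    have c3 := h.curv_mixed he hJ hy he
    have hG' : e * (e * Γ J e) = e * Γ J e := by linear_combination Γ J e * he
    have d1 := (h.dnorm J).apply_idem_right he hxy
    have d2 := (h.dnorm J).apply_idem_right he hy
    have d3 := h.norm.apply_idem_right he hxy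
    have d4 := h.norm.apply_idem_right he hy
    have s1 := h.norm.cocycle x (e * Γ J e) y
    rw [h.norm.symm (e * Γ J e), h.norm.symm (e * Γ J e), mul_comm (e * Γ J e) y] at s1
    rw [hG', mul_comm (x * y) e, hxy] at c2
    rw [hG', mul_comm y e, hy] at c3
    linear_combination c1 - c2 + x * c3 - d1 + x * d2 - e * Γ J e * d3 + x * (e * Γ J e) * d4 - e * s1
      + (dΓ (x * y) J e - x * dΓ y J e) * he
  have hx : e * (e * x) = e * x := by linear_combination x * he
  have hy : e * (e * y) = e * y := by linear_combination y * he
  have := key _ _ hx hy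
  rw [blockPart_apply]
  rw [show e * x * (e * y) = e * (x * y) by linear_combination x * y * he] at this
  linear_combination this + (x * y * dΓ e J e - x * y * dΓ J e e - x * dΓ (e * y) J e
    - y * dΓ (e * x) J e) * he

/-- For arguments in the block, the part of `Γ y z` outside it depends only on the product `y * z`
(`hf`). Its contributions to the curvature identity at `(x, y, z, e)` therefore cancel, and only
data of the block remain. -/
theorem IsFlatJet.curv_block (h : IsFlatJet Γ dΓ) (he : e * e = e) {x y z : A}
    (hx : e * x = x) (hy : e * y = y) (hz : e * z = z) :
    e * dΓ x y z - e * dΓ y x z + e * Γ x (e * Γ y z) - e * Γ y (e * Γ x z)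
      = x * (e * dΓ e y z - z * (e * dΓ y e e) + e * Γ e e * Γ y z - e * Γ y (z * (e * Γ e e)))
      - y * (e * dΓ e x z - z * (e * dΓ x e e) + e * Γ e e * Γ x z
        - e * Γ x (z * (e * Γ e e))) := by
  have hf : ∀ y z, e * y = y → e * z = z → (1 - e) * Γ y z = -((1 - e) * Γ (1 - e) (y * z)) := by
    intro y z hy hz
    have e1 := h.norm.cocycle y (1 - e) z
    rw [show (1 - e) * z = 0 by linear_combination -hz, map_zero,
      show y * z = y * z from rfl] at e1
    linear_combination -(1 - e) * e1 - Γ y z * he - Γ (1 - e) z * hy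
  have hΓ : ∀ x y z, e * x = x → e * y = y → e * z = z → e * Γ x (Γ y z)
      = e * Γ x (e * Γ y z) - x * (e * Γ ((1 - e) * Γ (1 - e) (y * z)) e) := by
    intro x y z hx hy hz
    have e4 : Γ x (Γ y z) = Γ x (e * Γ y z) + Γ x ((1 - e) * Γ y z) := by
      rw [← map_add]; congr 1; ring
    rw [hf y z hy hz, map_neg] at e4
    have e5 : e * ((1 - e) * Γ (1 - e) (y * z)) = 0 := by
      linear_combination -(Γ (1 - e) (y * z)) * he
    have e6 := h.norm.apply_idem_mul e5 hx
    rw [h.norm.symm] at e6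
    linear_combination e * e4 - e6
  have aux : ∀ y, e * y = y → e * curvOf Γ dΓ e y z
      = e * dΓ e y z - z * (e * dΓ y e e) + e * Γ e e * Γ y z - e * Γ y (z * (e * Γ e e))
        - e * Γ ((1 - e) * Γ (1 - e) (y * z)) e
        + y * (e * Γ ((1 - e) * Γ (1 - e) z) e) := by
    intro y hy
    have a1 := hΓ e y z he hy hz
    have a2 := hΓ y e z hy he hz
    have a3 := (h.dnorm y).apply_idem_right he hz
    have a4 := h.norm.apply_idem_right he hz
    have a5 := h.norm.apply_idem_right he (x := e * Γ y z)
      (by linear_combination Γ y z * he)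
    rw [(h.dnorm y).symm] at a3
    rw [h.norm.symm] at a4 a5
    rw [hz, a4] at a2
    simp only [curvOf]
    linear_combination a1 - a2 - a3 + a5
      + (Γ y z * Γ e e - Γ ((1 - e) * Γ (1 - e) (y * z)) e) * he
  have e1 := h.curv x y z e
  have e2 := aux x hx
  have e3 := aux y hy
  have e4 := hΓ x y z hx hy hz
  have e5 := hΓ y x z hy hx hz
  have e7 : curvOf Γ dΓ y e z = - curvOf Γ dΓ e y z := by simp only [curvOf]; ring
  have e8 : curvOf Γ dΓ x y z = dΓ x y z - dΓ y x z + Γ x (Γ y z) - Γ y (Γ x z) := rfl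
  rw [e7] at e1
  rw [e8] at e1
  linear_combination e * e1 + x * e3 - y * e2 - e4 + e5
    - (dΓ x y z - dΓ y x z + Γ x (Γ y z) - Γ y (Γ x z)) * he

/-- The curvature within a block in terms of the normalized component. -/
theorem IsFlatJet.blockPart_flat (h : IsFlatJet Γ dΓ) (he : e * e = e) (k i l : A) :
    blockPart e (dΓ (e * k)) i l - k * blockPart e (dΓ (e * 1)) i l
      - (blockPart e (dΓ (e * i)) k l - i * blockPart e (dΓ (e * 1)) k l)
      + blockPart e Γ k (blockPart e Γ i l) - blockPart e Γ i (blockPart e Γ k l) = 0 := by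
  have hh : ∀ x, e * (e * x) = e * x := fun x => by linear_combination x * he
  have c := h.curv_block he (hh k) (hh i) (hh l)
  have s := h.norm.cocycle (e * k) (e * i) (e * l * (e * Γ e e))
  have e1 : ∀ x y, e * Γ (e * x) (e * blockPart e Γ y l)
      = e * Γ (e * x) (e * Γ (e * y) (e * l)) - e * Γ (e * x) (e * y * (e * l * (e * Γ e e))) := by
    intro x y
    rw [← mul_sub, ← map_sub, blockPart_apply]
    congr 2
    linear_combination (Γ (e * y) (e * l) + e * y * l * Γ e e) * he
  have e2 := e1 k i
  have e3 := e1 i k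
  rw [blockPart_apply e Γ k (blockPart e Γ i l), blockPart_apply e Γ i (blockPart e Γ k l), e2, e3]
  simp only [blockPart_apply, mul_one]
  linear_combination c - e * s + (k * dΓ e (e * i) (e * l) - i * dΓ e (e * k) (e * l)
    + i * l * dΓ (e * k) e e * (1 + e) - k * l * dΓ (e * i) e e * (1 + e)) * he

end Block

/-! ### The algebra of the product `∘` -/

section Algebra

open Polynomial Module

variable {r : ℕ} {m : Fin r → ℕ}

/-- The algebra `∏_α ℝ[ε] / (ε ^ m_α)`. -/
def Alg (m : Fin r → ℕ) : Type := ∀ a, AdjoinRoot (X ^ m a : ℝ[X])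

instance : CommRing (Alg m) := inferInstanceAs (CommRing (∀ a, AdjoinRoot (X ^ m a : ℝ[X])))

instance : Algebra ℝ (Alg m) := inferInstanceAs (Algebra ℝ (∀ a, AdjoinRoot (X ^ m a : ℝ[X])))

/-- The idempotent of a block. -/
def idem (a : Fin r) : Alg m := fun b => if b = a then 1 else 0

/-- The nilpotent generator of a block. -/
def nil (a : Fin r) : Alg m := fun b => if b = a then AdjoinRoot.root _ else 0

theorem Alg.mul_apply (x y : Alg m) (a : Fin r) : (x * y) a = x a * y a := rfl

theorem Alg.pow_apply (x : Alg m) (k : ℕ) (a : Fin r) : (x ^ k) a = x a ^ k := rfl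

theorem Alg.zero_apply (a : Fin r) : (0 : Alg m) a = 0 := rfl

theorem idem_apply (a b : Fin r) : (idem a : Alg m) b = if b = a then 1 else 0 := rfl

theorem nil_apply (a b : Fin r) :
    (nil a : Alg m) b = if b = a then AdjoinRoot.root _ else 0 := rfl

theorem idem_mul_self (a : Fin r) : (idem a : Alg m) * idem a = idem a := by
  funext b
  rw [Alg.mul_apply, idem_apply]
  split_ifs <;> simp

theorem idem_mul_idem {a b : Fin r} (h : a ≠ b) : (idem a : Alg m) * idem b = 0 := by
  funext c
  rw [Alg.mul_apply, idem_apply, idem_apply, Alg.zero_apply]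
  by_cases h1 : c = a
  · subst h1; simp [h]
  · simp [h1]

theorem idem_mul_nil (a : Fin r) : (idem a : Alg m) * nil a = nil a := by
  funext b
  rw [Alg.mul_apply, idem_apply, nil_apply]
  split_ifs <;> simp

theorem idem_mul_pow_apply (a b : Fin r) (k : ℕ) :
    ((idem a * nil a ^ k : Alg m) b) = if b = a then AdjoinRoot.root _ ^ k else 0 := by
  rw [Alg.mul_apply, Alg.pow_apply, idem_apply, nil_apply]
  split_ifs <;> simp

theorem idem_mul_pow_eq_zero (a : Fin r) {k : ℕ} (h : m a ≤ k) :
    (idem a : Alg m) * nil a ^ k = 0 := by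
  funext b
  rw [idem_mul_pow_apply]
  split_ifs with hb
  · subst hb
    have : (AdjoinRoot.root (X ^ m b : ℝ[X])) ^ m b = 0 := by
      have := AdjoinRoot.eval₂_root (X ^ m b : ℝ[X])
      simpa using this
    obtain ⟨c, rfl⟩ := Nat.exists_eq_add_of_le h
    rw [pow_add, this, zero_mul]; rfl
  · rfl

theorem sum_idem : ∑ a, (idem a : Alg m) = 1 := by
  funext b
  have : (∑ a, (idem a : Alg m)) b = ∑ a, (idem a : Alg m) b := Finset.sum_apply _ _ _
  rw [this]
  change ∑ a, (if b = a then (1 : AdjoinRoot (X ^ m b : ℝ[X])) else 0) = 1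
  simp

/-- Positions in a block, counted from zero. -/
def posEquiv (n : ℕ) : Fin n ≃ ↥(Finset.Icc 1 n) where
  toFun i := ⟨i + 1, by simp⟩
  invFun i := ⟨i - 1, by have := i.2; rw [Finset.mem_Icc] at this; omega⟩
  left_inv i := by simp
  right_inv i := by
    have := i.2
    rw [Finset.mem_Icc] at this
    apply Subtype.ext
    simp only
    omega

/-- The basis `ε_α ^ (i - 1)` of a block. -/
def blockBasis (n : ℕ) : Basis ↥(Finset.Icc 1 n) ℝ (AdjoinRoot (X ^ n : ℝ[X])) :=
  ((AdjoinRoot.powerBasis' (monic_X_pow n)).basis.reindex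
    (finCongr (by simp))).reindex (posEquiv n)

theorem blockBasis_apply (n : ℕ) (i : ↥(Finset.Icc 1 n)) :
    blockBasis n i = AdjoinRoot.root (X ^ n : ℝ[X]) ^ ((i : ℕ) - 1) := by
  simp [blockBasis, posEquiv]

/-- The coordinate basis `∂_{i(α)}`. -/
def bas : Basis (BIdx m) ℝ (Alg m) :=
  (Pi.basis fun a => blockBasis (m a) : Basis (BIdx m) ℝ (∀ a, AdjoinRoot (X ^ m a : ℝ[X])))

theorem bas_apply (I : BIdx m) : (bas I : Alg m) = idem I.1 * nil I.1 ^ ((I.2 : ℕ) - 1) := by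
  funext b
  rw [idem_mul_pow_apply]
  have : (bas I : Alg m) = Pi.single I.1 (blockBasis (m I.1) I.2) := Pi.basis_apply _ _
  rw [this, blockBasis_apply]
  by_cases h : b = I.1
  · subst h; simp
  · simp [h]

theorem mem_pos {I : BIdx m} : 1 ≤ (I.2 : ℕ) ∧ (I.2 : ℕ) ≤ m I.1 := Finset.mem_Icc.1 I.2.2

theorem bas_mk (a : Fin r) (i : ℕ) (h : i + 1 ∈ Finset.Icc 1 (m a)) :
    (bas ⟨a, i + 1, h⟩ : Alg m) = idem a * nil a ^ i := by
  rw [bas_apply]; rfl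

theorem idem_mul_bas (I : BIdx m) : idem I.1 * (bas I : Alg m) = bas I := by
  rw [bas_apply, ← mul_assoc, idem_mul_self]

theorem idem_mul_bas_of_ne {a : Fin r} {I : BIdx m} (h : I.1 ≠ a) :
    idem a * (bas I : Alg m) = 0 := by
  rw [bas_apply, ← mul_assoc, idem_mul_idem h.symm, zero_mul]

/-- The product of two basis vectors. -/
theorem bas_mul_bas (J K : BIdx m) : (bas J * bas K : Alg m) = ∑ I, sc I J K • bas I := by
  obtain ⟨a, j, hj⟩ := J
  obtain ⟨b, k, hk⟩ := K
  rw [Finset.mem_Icc] at hj hk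
  by_cases hab : a = b
  · subst hab
    have h1 : (bas ⟨a, j, Finset.mem_Icc.2 hj⟩ * bas ⟨a, k, Finset.mem_Icc.2 hk⟩ : Alg m)
        = idem a * nil a ^ (j + k - 2) := by
      rw [bas_apply, bas_apply]
      simp only
      rw [show j + k - 2 = (j - 1) + (k - 1) by omega, pow_add]
      linear_combination nil a ^ (j - 1) * nil a ^ (k - 1) * idem_mul_self (m := m) a
    rw [h1]
    by_cases hle : j + k - 1 ≤ m a
    · rw [Finset.sum_eq_single (⟨a, j + k - 2 + 1, by rw [Finset.mem_Icc]; omega⟩ : BIdx m)]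
      · rw [bas_mk, sc, if_pos, one_smul]
        refine ⟨rfl, rfl, ?_⟩
        simp only; omega
      · rintro ⟨c, i, hi⟩ - hne
        rw [sc, if_neg, zero_smul]
        rintro ⟨h1, -, h3⟩
        simp only at h1 h3
        subst h1
        apply hne
        have : i = j + k - 2 + 1 := by omega
        subst this; rfl
      · simp
    · rw [idem_mul_pow_eq_zero a (by omega), Finset.sum_eq_zero]
      rintro ⟨c, i, hi⟩ -
      rw [sc, if_neg, zero_smul]
      rintro ⟨h1, -, h3⟩
      simp only at h1 h3
      subst h1
      rw [Finset.mem_Icc] at hi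
      omega
  · rw [bas_apply, bas_apply, Finset.sum_eq_zero]
    · simp only
      linear_combination nil a ^ (j - 1) * nil b ^ (k - 1) * idem_mul_idem (m := m) hab
    · rintro ⟨c, i, hi⟩ -
      rw [sc, if_neg, zero_smul]
      rintro ⟨h1, h2, -⟩
      exact hab (h1.trans h2.symm)

theorem sum_unit_bas (hm : ∀ a, 1 ≤ m a) : ∑ I, unit I • (bas I : Alg m) = 1 := by
  rw [← sum_idem, Fintype.sum_sigma]
  refine Finset.sum_congr rfl fun a _ => ?_
  rw [Finset.sum_eq_single (⟨0 + 1, by have := hm a; simpa using this⟩ : ↥(Finset.Icc 1 (m a)))]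
  · rw [bas_mk]; simp [unit]
  · rintro ⟨i, hi⟩ - hne
    rw [unit, if_neg, zero_smul]
    rintro h
    simp only at h
    subst h
    exact hne rfl
  · simp

theorem comp_mk (f : BIdx m → ℝ) (a : Fin r) (i : ↥(Finset.Icc 1 (m a))) :
    comp f a i = f ⟨a, i⟩ := by
  rw [comp, dif_pos i.2]

theorem sum_pos {M : Type*} [AddCommMonoid M] (n : ℕ) (f : ℕ → M) :
    ∑ i : ↥(Finset.Icc 1 n), f i = ∑ k ∈ Finset.range n, f (k + 1) := by
  rw [← Fin.sum_univ_eq_sum_range (fun k => f (k + 1)) n]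
  exact (Fintype.sum_equiv (posEquiv n) _ _ fun i => rfl).symm

theorem idem_mul_sum (x : BIdx m → ℝ) (a : Fin r) :
    idem a * ∑ I, x I • (bas I : Alg m)
      = ∑ k ∈ Finset.range (m a), comp x a (k + 1) • (idem a * nil a ^ k) := by
  rw [Fintype.sum_sigma, Finset.mul_sum, Finset.sum_eq_single a]
  · refine Eq.trans ?_
      (sum_pos (m a) fun i => comp x a i • ((idem a : Alg m) * nil a ^ (i - 1)))
    rw [Finset.mul_sum]
    refine Finset.sum_congr rfl fun i _ => ?_
    rw [comp_mk, mul_smul_comm, idem_mul_bas ⟨a, i⟩, bas_apply]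
  · intro b _ hb
    rw [Finset.mul_sum, Finset.sum_eq_zero]
    intro i _
    rw [mul_smul_comm, idem_mul_bas_of_ne (by exact hb), smul_zero]
  · simp

/-- In a truncated polynomial algebra an element with nonzero linear coefficient generates. -/
theorem exists_aeval_eq {A : Type*} [CommRing A] [Algebra ℝ A] {ε : A} {n : ℕ} (hn : ε ^ n = 0)
    (hε : ∀ y : A, ∃ (t : ℝ) (y' : A), y = algebraMap ℝ A t + ε * y') {l c : ℝ} (hc : c ≠ 0)
    {w ζ : A} (hζ : ζ = algebraMap ℝ A l + ε * (algebraMap ℝ A c + ε * w)) (y : A) :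
    ∃ p : ℝ[X], aeval ζ p = y := by
  have hpow : ∀ k : ℕ, ∃ s, (algebraMap ℝ A c + ε * w) ^ k = algebraMap ℝ A (c ^ k) + ε * s := by
    intro k
    induction k with
    | zero => exact ⟨0, by simp⟩
    | succ k ih =>
      obtain ⟨s, hs⟩ := ih
      refine ⟨s * (algebraMap ℝ A c + ε * w) + algebraMap ℝ A (c ^ k) * w, ?_⟩
      rw [pow_succ, hs, pow_succ, map_mul]
      ring
  -- Downward induction on the order of vanishing: `(ζ - l)^k` has leading term `c^k ε^k`, so a
  -- multiple of it removes the leading coefficient `t` of `ε^k * y`.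
  have key : ∀ k ≤ n, ∀ y, ∃ p : ℝ[X], aeval ζ p = ε ^ k * y := by
    intro k hk
    induction hk using Nat.decreasingInduction with
    | self => intro y; exact ⟨0, by simp [hn]⟩
    | of_succ k _ ih =>
      intro y
      obtain ⟨t, y', rfl⟩ := hε y
      obtain ⟨s, hs⟩ := hpow k
      obtain ⟨p, hp⟩ := ih (y' - algebraMap ℝ A (t * (c ^ k)⁻¹) * s)
      refine ⟨p + C (t * (c ^ k)⁻¹) * (X - C l) ^ k, ?_⟩
      have h1 : ζ - algebraMap ℝ A l = ε * (algebraMap ℝ A c + ε * w) := by rw [hζ]; ring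
      have h2 : algebraMap ℝ A (t * (c ^ k)⁻¹) * algebraMap ℝ A (c ^ k) = algebraMap ℝ A t := by
        rw [← map_mul]
        congr 1
        field_simp
      simp only [map_add, map_mul, map_pow, map_sub, aeval_X, aeval_C, hp, h1, mul_pow, hs]
      simp only [map_mul, map_pow] at h2 ⊢
      linear_combination ε ^ k * h2
  simpa using key 0 (Nat.zero_le _) y

theorem aeval_alg_apply (ξ : Alg m) (p : ℝ[X]) (a : Fin r) :
    (aeval ξ p : Alg m) a = aeval (ξ a) p := by
  let f : Alg m →ₐ[ℝ] AdjoinRoot (X ^ m a : ℝ[X]) :=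
    Pi.evalAlgHom ℝ (fun a => AdjoinRoot (X ^ m a : ℝ[X])) a
  exact (aeval_algHom_apply f ξ p).symm

/-- An element with distinct leading and nonzero subleading components generates the algebra. -/
theorem submodule_eq_top (hm : ∀ a, 1 ≤ m a) (x : BIdx m → ℝ)
    (hd : ∀ a b, a ≠ b → comp x a 1 ≠ comp x b 1) (hn : ∀ a, 2 ≤ m a → comp x a 2 ≠ 0)
    (C : Submodule ℝ (Alg m)) (h1 : 1 ∈ C)
    (hmul : ∀ c ∈ C, (∑ I, x I • (bas I : Alg m)) * c ∈ C) : C = ⊤ := by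
  set ξ : Alg m := ∑ I, x I • (bas I : Alg m) with hξ
  have hroot : ∀ a, (AdjoinRoot.root (X ^ m a : ℝ[X])) ^ m a = 0 := by
    intro a
    have := AdjoinRoot.eval₂_root (X ^ m a : ℝ[X])
    simpa using this
  have hform : ∀ a, ∃ (c : ℝ) (w : AdjoinRoot (X ^ m a : ℝ[X])), c ≠ 0 ∧
      ξ a = algebraMap ℝ _ (comp x a 1)
        + AdjoinRoot.root _ * (algebraMap ℝ _ c + AdjoinRoot.root _ * w) := by
    intro a
    have e1 : ξ a = ∑ k ∈ Finset.range (m a), comp x a (k + 1) • AdjoinRoot.root (X ^ m a : ℝ[X]) ^ k := by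
      have := congrFun (idem_mul_sum x a) a
      rw [Alg.mul_apply, idem_apply, if_pos rfl, one_mul] at this
      rw [hξ, this]
      refine (Finset.sum_apply (M := fun a => AdjoinRoot (X ^ m a : ℝ[X])) a _ _).trans ?_
      refine Finset.sum_congr rfl fun k _ => ?_
      change comp x a (k + 1) • (((idem a : Alg m) * nil a ^ k : Alg m) a) = _
      rw [idem_mul_pow_apply, if_pos rfl]
    rcases Nat.lt_or_ge 1 (m a) with h | h
    · obtain ⟨n, hn'⟩ := Nat.exists_eq_add_of_le' h
      refine ⟨comp x a 2, ∑ k ∈ Finset.range n, comp x a (k + 3) •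
        AdjoinRoot.root (X ^ m a : ℝ[X]) ^ k, hn a h, ?_⟩
      rw [e1]
      have e2 : Finset.range (m a) = Finset.range (n + 1 + 1) := by rw [hn']
      rw [e2, Finset.sum_range_succ', Finset.sum_range_succ', Algebra.algebraMap_eq_smul_one,
        Algebra.algebraMap_eq_smul_one, mul_add, mul_smul_comm, Finset.mul_sum, Finset.mul_sum]
      simp only [pow_zero, zero_add, pow_one, mul_one, mul_smul_comm, ← pow_succ']
      abel
    -- In a block of size one the root is zero, so any nonzero linear coefficient will do.
    · have hm1 : m a = 1 := le_antisymm h (hm a)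
      have hr := hroot a
      refine ⟨1, 0, one_ne_zero, ?_⟩
      have e2 : Finset.range (m a) = Finset.range 1 := by rw [hm1]
      have e3 : AdjoinRoot.root (X ^ m a : ℝ[X]) = 0 := by
        have := hr
        rwa [show (AdjoinRoot.root (X ^ m a : ℝ[X])) ^ m a
          = (AdjoinRoot.root (X ^ m a : ℝ[X])) ^ 1 from congrArg _ hm1, pow_one] at this
      rw [e1, e2, e3, Finset.sum_range_one, Algebra.algebraMap_eq_smul_one]
      simp
  choose c w hc hform using hform
  have hsurj : ∀ a (y : AdjoinRoot (X ^ m a : ℝ[X])), ∃ p : ℝ[X], aeval (ξ a) p = y := by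
    intro a y
    refine exists_aeval_eq (hroot a) ?_ (hc a) (hform a) y
    intro y
    obtain ⟨p, rfl⟩ := AdjoinRoot.mk_surjective y
    refine ⟨p.coeff 0, AdjoinRoot.mk _ p.divX, ?_⟩
    conv_lhs => rw [← X_mul_divX_add p]
    rw [map_add, map_mul, AdjoinRoot.mk_X, AdjoinRoot.mk_C, add_comm]
    rfl
  -- The kernel for block `a` contains a power of `X - x^{1(a)}`. These numbers are distinct, so the
  -- kernels are pairwise coprime and the Chinese remainder theorem glues the polynomials found
  -- block by block.
  have hcop : Pairwise (Function.onFun IsCoprime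
      fun a => RingHom.ker (aeval (ξ a) : ℝ[X] →ₐ[ℝ] AdjoinRoot (X ^ m a : ℝ[X])).toRingHom) := by
    have hin : ∀ a, (X - Polynomial.C (comp x a 1)) ^ m a ∈
        RingHom.ker (aeval (ξ a) : ℝ[X] →ₐ[ℝ] AdjoinRoot (X ^ m a : ℝ[X])).toRingHom := by
      intro a
      rw [RingHom.mem_ker]
      change aeval (ξ a) _ = 0
      rw [map_pow, map_sub, aeval_X, aeval_C, hform a, add_sub_cancel_left, mul_pow, hroot,
        zero_mul]
    intro a b hab
    have h2 : IsCoprime ((X - Polynomial.C (comp x a 1)) ^ m a)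
        ((X - Polynomial.C (comp x b 1)) ^ m b) :=
      (isCoprime_X_sub_C_of_isUnit_sub (sub_ne_zero.2 (hd a b hab)).isUnit).pow
    obtain ⟨u, v, huv⟩ := h2
    rw [Function.onFun, Ideal.isCoprime_iff_exists]
    exact ⟨_, Ideal.mul_mem_left _ u (hin a), _, Ideal.mul_mem_left _ v (hin b), huv⟩
  rw [eq_top_iff]
  rintro y -
  choose p hp using fun a => hsurj a (y a)
  obtain ⟨q, hq⟩ := Ideal.exists_forall_sub_mem_ideal hcop p
  have hy : aeval ξ q = y := by
    funext a
    rw [aeval_alg_apply, ← hp a, ← sub_eq_zero, ← map_sub]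
    exact hq a
  have hC : ∀ q : ℝ[X], aeval ξ q ∈ C := by
    intro q
    induction q using Polynomial.induction_on with
    | C t => rw [aeval_C, Algebra.algebraMap_eq_smul_one]; exact C.smul_mem t h1
    | add p q hp hq => rw [map_add]; exact C.add_mem hp hq
    | monomial n t ih =>
      have := hmul _ ih
      rwa [show ξ * aeval ξ (Polynomial.C t * X ^ n) = aeval ξ (Polynomial.C t * X ^ (n + 1)) by
        simp only [map_mul, map_pow, aeval_X, aeval_C]; ring] at this
  rw [← hy]
  exact hC q

end Algebra

/-! ### The connection as a bilinear map -/

section Connection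

open Module

variable {r : ℕ} {m : Fin r → ℕ}

/-- Families with the index structure of Christoffel symbols. -/
abbrev Tup (m : Fin r → ℕ) : Type := BIdx m → BIdx m → BIdx m → ℝ

/-- The bilinear map with structure constants `g I J K`. -/
def bil : Tup m →ₗ[ℝ] Alg m →ₗ[ℝ] Alg m →ₗ[ℝ] Alg m where
  toFun g := bas.constr ℝ fun J => bas.constr ℝ fun K => ∑ I, g I J K • bas I
  map_add' g g' := by
    refine bas.ext fun J => bas.ext fun K => ?_
    simp [add_smul, Finset.sum_add_distrib]
  map_smul' c g := by
    refine bas.ext fun J => bas.ext fun K => ?_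
    simp [mul_smul, Finset.smul_sum]

theorem bil_bas (g : Tup m) (J K : BIdx m) : bil g (bas J) (bas K) = ∑ I, g I J K • bas I := by
  simp [bil]

theorem eq_zero_of_bas {M : Type*} [AddCommGroup M] [Module ℝ M] {f : Alg m → M}
    (hf : IsLinearMap ℝ f) (h : ∀ I, f (bas I) = 0) (x : Alg m) : f x = 0 := by
  have : hf.mk' f = 0 := bas.ext fun I => h I
  exact LinearMap.congr_fun this x

/-- Linear relations with constant coefficients are inherited by the partial derivatives. -/
theorem pd_mem {U : Set (Pt m)} (hU : IsOpen U) {Γ : BIdx m → BIdx m → BIdx m → Pt m → ℝ}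
    (hΓ : ∀ I J K, ContDiffOn ℝ ∞ (Γ I J K) U) {V : Type*} [AddCommGroup V] [Module ℝ V]
    (T : Tup m →ₗ[ℝ] V) (N : Submodule ℝ V) (h : ∀ u ∈ U, T (fun I J K => Γ I J K u) ∈ N)
    {u : Pt m} (hu : u ∈ U) (L : BIdx m) : T (fun I J K => pd L (Γ I J K) u) ∈ N := by
  -- Membership in `N` is tested by linear functionals on the quotient; each gives a scalar function
  -- that vanishes on `U`, hence has zero derivative.
  rw [← Submodule.Quotient.mk_eq_zero, ← Module.forall_dual_apply_eq_zero_iff ℝ]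
  intro φ
  let ψ : Tup m →ₗ[ℝ] ℝ := φ ∘ₗ N.mkQ ∘ₗ T
  have hd : ∀ I J K, DifferentiableAt ℝ (Γ I J K) u := fun I J K =>
    ((hΓ I J K).differentiableOn (by simp)).differentiableAt (hU.mem_nhds hu)
  have h1 : HasFDerivAt (fun u => (fun I J K => Γ I J K u : Tup m))
      (ContinuousLinearMap.pi fun I => ContinuousLinearMap.pi fun J =>
        ContinuousLinearMap.pi fun K => fderiv ℝ (Γ I J K) u) u := by
    refine hasFDerivAt_pi.2 fun I => hasFDerivAt_pi.2 fun J => hasFDerivAt_pi.2 fun K => ?_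
    exact (hd I J K).hasFDerivAt
  have h2 := (LinearMap.toContinuousLinearMap ψ).hasFDerivAt.comp u h1
  have h3 : HasFDerivAt (LinearMap.toContinuousLinearMap ψ ∘
      fun u => (fun I J K => Γ I J K u : Tup m)) (0 : Pt m →L[ℝ] ℝ) u := by
    refine (hasFDerivAt_const (0 : ℝ) u).congr_of_eventuallyEq ?_
    filter_upwards [hU.mem_nhds hu] with v hv
    have := (Submodule.Quotient.mk_eq_zero N).2 (h v hv)
    change φ (N.mkQ (T _)) = 0
    rw [Submodule.mkQ_apply, this, map_zero]
  have h4 := h2.unique h3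
  exact congrArg (fun f : Pt m →L[ℝ] ℝ => f (Pi.single L 1)) h4

/-- The normalized symmetric cocycles. -/
def normalized (A : Type*) [CommRing A] [Algebra ℝ A] : Submodule ℝ (A →ₗ[ℝ] A →ₗ[ℝ] A) where
  carrier := {H | IsNormalized H}
  zero_mem' := ⟨by simp, by simp, by intro x y z; simp⟩
  add_mem' := by
    intro H H' h h'
    refine ⟨fun x y => ?_, fun x => ?_, fun x y z => ?_⟩
    · simp only [LinearMap.add_apply, h.symm x, h'.symm x]
    · simp only [LinearMap.add_apply, h.unit, h'.unit, add_zero]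
    · simp only [LinearMap.add_apply]
      linear_combination h.cocycle x y z + h'.cocycle x y z
  smul_mem' := by
    intro c H h
    refine ⟨fun x y => ?_, fun x => ?_, fun x y z => ?_⟩
    · simp only [LinearMap.smul_apply, h.symm x]
    · simp only [LinearMap.smul_apply, h.unit, smul_zero]
    · simp only [LinearMap.smul_apply, mul_smul_comm]
      rw [← smul_sub, h.cocycle x y z, smul_sub]

/-- The ideal of elements whose components of position at most `k` vanish. -/
def fil (m : Fin r → ℕ) (k : ℕ) : Ideal (Alg m) := Ideal.span {(∑ a, nil a) ^ k}

theorem idem_mul_sum_nil_pow (a : Fin r) (k : ℕ) :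
    (idem a : Alg m) * (∑ b, nil b) ^ k = idem a * nil a ^ k := by
  induction k with
  | zero => simp
  | succ k ih =>
    have h : (idem a : Alg m) * ∑ b, nil b = nil a := by
      rw [Finset.mul_sum, Finset.sum_eq_single a]
      · exact idem_mul_nil a
      · intro b _ hb
        rw [← idem_mul_nil b, ← mul_assoc, idem_mul_idem hb.symm, zero_mul]
      · simp
    have h2 : (idem a : Alg m) * (∑ b, nil b) ^ (k + 1)
        = (idem a * ∑ b, nil b) * (idem a * (∑ b, nil b) ^ k) := by
      linear_combination -((∑ b, nil b) ^ (k + 1)) * idem_mul_self (m := m) a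
    rw [h2, h, ih, pow_succ]
    ring

theorem smul_mem_fil {k : ℕ} (c : ℝ) {x : Alg m} (hx : x ∈ fil m k) : c • x ∈ fil m k := by
  rw [Algebra.smul_def]
  exact Ideal.mul_mem_left _ _ hx

theorem bas_mem_fil {I : BIdx m} {k : ℕ} (h : k < (I.2 : ℕ)) : (bas I : Alg m) ∈ fil m k := by
  obtain ⟨c, hc⟩ := Nat.exists_eq_add_of_lt h
  rw [fil, Ideal.mem_span_singleton]
  refine ⟨idem I.1 * nil I.1 ^ c, ?_⟩
  rw [bas_apply, hc, Nat.add_sub_cancel, pow_add]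
  linear_combination (-(nil I.1) ^ c) * idem_mul_sum_nil_pow (m := m) I.1 k

theorem repr_of_mem_fil {x : Alg m} {k : ℕ} (hx : x ∈ fil m k) {I : BIdx m}
    (h : (I.2 : ℕ) ≤ k) : bas.repr x I = 0 := by
  rw [fil, Ideal.mem_span_singleton] at hx
  obtain ⟨y, rfl⟩ := hx
  have hlin : IsLinearMap ℝ fun y : Alg m => bas.repr ((∑ a, nil a) ^ k * y) I :=
    ⟨fun y z => by simp [mul_add], fun c y => by simp⟩
  refine eq_zero_of_bas hlin (fun K => ?_) y
  have h1 : (∑ a, nil a) ^ k * (bas K : Alg m) = idem K.1 * nil K.1 ^ (k + ((K.2 : ℕ) - 1)) := by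
    rw [bas_apply, pow_add]
    linear_combination nil K.1 ^ ((K.2 : ℕ) - 1) * idem_mul_sum_nil_pow (m := m) K.1 k
  rw [h1]
  by_cases hk : m K.1 ≤ k + ((K.2 : ℕ) - 1)
  · rw [idem_mul_pow_eq_zero _ hk]; simp
  · have hmem : k + ((K.2 : ℕ) - 1) + 1 ∈ Finset.Icc 1 (m K.1) := by
      rw [Finset.mem_Icc]; omega
    rw [← bas_mk K.1 _ hmem, Basis.repr_self, Finsupp.single_apply, if_neg]
    rintro rfl
    simp only at h
    omega

/-- Bilinear maps that respect the filtration. -/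
def filtered (m : Fin r → ℕ) : Submodule ℝ (Alg m →ₗ[ℝ] Alg m →ₗ[ℝ] Alg m) where
  carrier := {H | ∀ k, ∀ x ∈ fil m k, ∀ y, H x y ∈ fil m k}
  zero_mem' := by intro k x _ y; simp
  add_mem' := by
    intro H H' h h' k x hx y
    exact (fil m k).add_mem (h k x hx y) (h' k x hx y)
  smul_mem' := by
    intro c H h k x hx y
    exact smul_mem_fil _ (h k x hx y)

/-- The vector field `X` at a point. -/
def vec (x : BIdx m → ℝ) : Alg m := ∑ I, x I • bas I

theorem vec_mul_bas (x : BIdx m → ℝ) (K : BIdx m) :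
    vec x * bas K = ∑ I, (∑ S, sc I K S * x S) • (bas I : Alg m) := by
  have h : ∀ S, (bas S * bas K : Alg m) = ∑ I, sc I K S • bas I := fun S => by
    rw [mul_comm, bas_mul_bas]
  rw [vec, Finset.sum_mul]
  simp only [smul_mul_assoc, h, Finset.smul_sum, Finset.sum_smul, smul_smul]
  rw [Finset.sum_comm]
  simp only [mul_comm (x _)]

variable {U : Set (Pt m)} {X : BIdx m → Pt m → ℝ} {Γ : BIdx m → BIdx m → BIdx m → Pt m → ℝ}

theorem IsDarbouxTsarev.bil_symm (h : IsDarbouxTsarev U X Γ) {u : Pt m} (hu : u ∈ U)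
    (x y : Alg m) : bil (fun I J K => Γ I J K u) x y = bil (fun I J K => Γ I J K u) y x := by
  have : bil (fun I J K => Γ I J K u) = (bil (fun I J K => Γ I J K u)).flip := by
    refine bas.ext fun J => bas.ext fun K => ?_
    rw [LinearMap.flip_apply, bil_bas, bil_bas]
    simp only [h.torsionless u hu _ J K]
  exact LinearMap.congr_fun₂ this x y

theorem IsDarbouxTsarev.bil_one (h : IsDarbouxTsarev U X Γ) (hm : ∀ a, 1 ≤ m a) {u : Pt m}
    (hu : u ∈ U) (x : Alg m) : bil (fun I J K => Γ I J K u) x 1 = 0 := by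
  have hlin : IsLinearMap ℝ fun x : Alg m => bil (fun I J K => Γ I J K u) x 1 :=
    ⟨fun y z => by simp, fun c y => by simp⟩
  refine eq_zero_of_bas hlin (fun J => ?_) x
  rw [← sum_unit_bas hm, map_sum]
  simp only [map_smul, bil_bas, Finset.smul_sum, smul_smul]
  rw [Finset.sum_comm]
  refine Finset.sum_eq_zero fun I _ => ?_
  rw [← Finset.sum_smul]
  have := h.flat_unit u hu J I
  rw [covVec, pd] at this
  simp only [fderiv_fun_const, Pi.zero_apply, _root_.zero_apply, zero_add] at this
  simp only [mul_comm (unit _), this, zero_smul]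

/-- The derivative of `X` as a linear map. -/
def dvec (X : BIdx m → Pt m → ℝ) (u : Pt m) : Alg m →ₗ[ℝ] Alg m :=
  bas.constr ℝ fun K => vec fun I => pd K (X I) u

/-- This is `d_∇(X∘) = 0` without indices; the terms `Γ^s_{jk} V^i_s` cancel by vanishing torsion.
-/
theorem IsDarbouxTsarev.bil_closed (h : IsDarbouxTsarev U X Γ) (hU : IsOpen U) {u : Pt m}
    (hu : u ∈ U) (x y : Alg m) :
    dvec X u x * y - dvec X u y * x
      + bil (fun I J K => Γ I J K u) x (vec (fun I => X I u) * y)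
      - bil (fun I J K => Γ I J K u) y (vec (fun I => X I u) * x) = 0 := by
  set g : Tup m := fun I J K => Γ I J K u with hg
  set ξ : Alg m := vec (fun I => X I u) with hξ
  let P : Alg m →ₗ[ℝ] Alg m →ₗ[ℝ] Alg m := (LinearMap.mul ℝ (Alg m)) ∘ₗ dvec X u
  let Q : Alg m →ₗ[ℝ] Alg m →ₗ[ℝ] Alg m := (bil g).compl₂ (LinearMap.mulLeft ℝ ξ)
  have hd : ∀ S, DifferentiableAt ℝ (X S) u := fun S =>
    ((h.smooth_X S).differentiableOn (by simp)).differentiableAt (hU.mem_nhds hu)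
  have hpd : ∀ I J K, pd J (mulOp X I K) u = ∑ S, sc I K S * pd J (X S) u := by
    intro I J K
    have : HasFDerivAt (mulOp X I K) (∑ S, sc I K S • fderiv ℝ (X S) u) u := by
      unfold mulOp
      exact HasFDerivAt.fun_sum fun S _ => (hd S).hasFDerivAt.const_mul _
    rw [pd, this.fderiv]
    simp [pd]
  have hP : ∀ J K, P (bas J) (bas K) = ∑ I, pd J (mulOp X I K) u • bas I := by
    intro J K
    change dvec X u (bas J) * bas K = _
    rw [dvec, Basis.constr_basis, vec_mul_bas]
    simp only [hpd]
  have hQ : ∀ J K, Q (bas J) (bas K) = ∑ I, (∑ S, Γ I J S u * mulOp X S K u) • bas I := by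
    intro J K
    change bil g (bas J) (ξ * bas K) = _
    rw [hξ, vec_mul_bas, map_sum]
    have h1 : ∀ S, bil g (bas J) ((∑ T, sc S K T * X T u) • bas S)
        = ∑ I, (Γ I J S u * mulOp X S K u) • bas I := by
      intro S
      rw [map_smul, bil_bas, Finset.smul_sum]
      simp only [smul_smul, mulOp, hg, mul_comm]
    refine (Finset.sum_congr rfl fun S _ => h1 S).trans ?_
    simp only [Finset.sum_smul]
    rw [Finset.sum_comm]
  have hZ : P - P.flip + Q - Q.flip = 0 := by
    refine bas.ext fun J => bas.ext fun K => ?_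
    simp only [LinearMap.sub_apply, LinearMap.add_apply, LinearMap.flip_apply, hP, hQ,
      LinearMap.zero_apply]
    rw [← Finset.sum_sub_distrib, ← Finset.sum_add_distrib, ← Finset.sum_sub_distrib]
    refine Finset.sum_eq_zero fun I _ => ?_
    rw [← sub_smul, ← add_smul, ← sub_smul]
    have := h.closed u hu I J K
    simp only [covEnd, h.torsionless u hu _ J K] at this
    rw [show pd J (mulOp X I K) u - pd K (mulOp X I J) u + ∑ S, Γ I J S u * mulOp X S K u
      - ∑ S, Γ I K S u * mulOp X S J u = 0 by linear_combination this, zero_smul]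
  exact LinearMap.congr_fun₂ hZ x y

/-- Setting `y = 1` in `bil_closed` solves for the derivative of `X`. Substituting it back leaves
the cocycle identity at the generator `X`. -/
theorem IsDarbouxTsarev.bil_normalized (h : IsDarbouxTsarev U X Γ) (hm : ∀ a, 1 ≤ m a)
    (hU : IsOpen U) {u : Pt m} (hu : u ∈ U) :
    IsNormalized (bil fun I J K => Γ I J K u) where
  symm := h.bil_symm hu
  unit := h.bil_one hm hu
  cocycle := by
    refine IsCocycle.of_generator (h.bil_symm hu) (h.bil_one hm hu)
      (ξ := vec fun I => X I u) ?_ ?_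
    · intro x y
      have e1 := h.bil_closed hU hu x y
      have e2 := h.bil_closed hU hu x 1
      have e3 := h.bil_closed hU hu y 1
      rw [h.bil_symm hu 1, h.bil_one hm hu, mul_one, mul_one] at e2 e3
      rw [mul_comm y, mul_comm x (vec _)]
      linear_combination e1 - y * e2 + x * e3
    · exact fun C => submodule_eq_top hm _ (h.distinct u hu) (h.nonzero u hu) C

theorem vec_mem_fil {x : BIdx m → ℝ} {k : ℕ} (h : ∀ I : BIdx m, (I.2 : ℕ) ≤ k → x I = 0) :
    vec x ∈ fil m k := by
  refine Submodule.sum_mem _ fun I _ => ?_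
  rcases Nat.lt_or_ge k I.2 with hk | hk
  · exact smul_mem_fil _ (bas_mem_fil hk)
  · rw [h I hk, zero_smul]; exact Submodule.zero_mem _

/-- The dependence condition on `X` says that its derivative preserves the filtration, hence so does
`x ↦ H x ξ`. The cocycle identity carries this to all products with the generator `ξ`. -/
theorem IsDarbouxTsarev.bil_filtered (h : IsDarbouxTsarev U X Γ) (hm : ∀ a, 1 ≤ m a)
    (hU : IsOpen U) {u : Pt m} (hu : u ∈ U) :
    bil (fun I J K => Γ I J K u) ∈ filtered m := by
  set H := bil fun I J K => Γ I J K u with hH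
  set ξ : Alg m := vec (fun I => X I u) with hξ
  have hN : IsNormalized H := h.bil_normalized hm hU hu
  have h0 : ∀ k, ∀ x ∈ fil m k, dvec X u x ∈ fil m k := by
    intro k x hx
    rw [← bas.sum_repr x, map_sum]
    refine Submodule.sum_mem _ fun K _ => ?_
    rw [map_smul]
    rcases Nat.lt_or_ge k K.2 with hk | hk
    · refine smul_mem_fil _ ?_
      rw [dvec, Basis.constr_basis]
      exact vec_mem_fil fun I hI => h.depends u hu I K (lt_of_le_of_lt hI hk)
    · rw [repr_of_mem_fil hx hk, zero_smul]; exact Submodule.zero_mem _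
  have h1 : ∀ k, ∀ x ∈ fil m k, H x ξ ∈ fil m k := by
    intro k x hx
    have e2 := h.bil_closed hU hu x 1
    rw [h.bil_symm hu 1, h.bil_one hm hu, mul_one, mul_one] at e2
    rw [show H x ξ = dvec X u 1 * x - dvec X u x by linear_combination e2]
    exact (fil m k).sub_mem (Ideal.mul_mem_left _ _ hx) (h0 k x hx)
  let C : Submodule ℝ (Alg m) :=
    { carrier := {c | ∀ k, ∀ x ∈ fil m k, H x c ∈ fil m k}
      zero_mem' := by intro k x _; simp
      add_mem' := by
        intro c d hc hd k x hx
        rw [map_add]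
        exact (fil m k).add_mem (hc k x hx) (hd k x hx)
      smul_mem' := by
        intro t c hc k x hx
        rw [map_smul]
        exact smul_mem_fil _ (hc k x hx) }
  have hC : C = ⊤ := by
    refine submodule_eq_top hm _ (h.distinct u hu) (h.nonzero u hu) C ?_ ?_
    · intro k x _
      rw [hN.unit]; exact Submodule.zero_mem _
    · intro c hc k x hx
      have e := hN.cocycle x ξ c
      rw [hN.symm ξ (x * c)] at e
      change H x (ξ * c) ∈ _
      rw [show H x (ξ * c) = ξ * H x c + H (x * c) ξ - x * H ξ c by linear_combination e]
      exact (fil m k).sub_mem ((fil m k).add_mem (Ideal.mul_mem_left _ _ (hc k x hx))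
        (h1 k _ (Ideal.mul_mem_right _ _ hx))) (Ideal.mul_mem_right _ _ hx)
  intro k x hx y
  have : y ∈ C := hC ▸ Submodule.mem_top
  exact this k x hx

/-- The derivative of the connection as a trilinear map; the first argument is the direction. -/
def dbil (Γ : BIdx m → BIdx m → BIdx m → Pt m → ℝ) (u : Pt m) :
    Alg m →ₗ[ℝ] Alg m →ₗ[ℝ] Alg m →ₗ[ℝ] Alg m :=
  bas.constr ℝ fun L => bil fun I J K => pd L (Γ I J K) u

theorem dbil_bas (u : Pt m) (L : BIdx m) :
    dbil Γ u (bas L) = bil fun I J K => pd L (Γ I J K) u := by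
  rw [dbil, Basis.constr_basis]

theorem dbil_mem {N : Submodule ℝ (Alg m →ₗ[ℝ] Alg m →ₗ[ℝ] Alg m)} (hU : IsOpen U)
    (hΓ : ∀ I J K, ContDiffOn ℝ ∞ (Γ I J K) U)
    (h : ∀ u ∈ U, bil (fun I J K => Γ I J K u) ∈ N) {u : Pt m} (hu : u ∈ U) (x : Alg m) :
    dbil Γ u x ∈ N := by
  rw [← bas.sum_repr x, map_sum]
  refine Submodule.sum_mem _ fun L _ => ?_
  rw [map_smul, dbil_bas]
  have := pd_mem (V := Alg m →ₗ[ℝ] Alg m →ₗ[ℝ] Alg m) hU hΓ bil N (fun u hu => h u hu) hu L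
  exact N.smul_mem _ this

theorem sum_curv (Γ : BIdx m → BIdx m → BIdx m → Pt m → ℝ) (u : Pt m) (L K I : BIdx m) :
    curvOf (bil fun I J K => Γ I J K u) (dbil Γ u) (bas K) (bas I) (bas L)
      = vec fun S => curv Γ S L K I u := by
  have h1 : ∀ K I L, bil (fun I J K => Γ I J K u) (bas K)
      (bil (fun I J K => Γ I J K u) (bas I) (bas L))
      = ∑ S, (∑ T, Γ S K T u * Γ T I L u) • (bas S : Alg m) := by
    intro K I L
    rw [bil_bas, map_sum]
    simp only [map_smul, bil_bas, Finset.smul_sum, smul_smul, Finset.sum_smul]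
    rw [Finset.sum_comm]
    simp only [mul_comm]
  rw [curvOf, h1, h1, dbil_bas, dbil_bas, bil_bas, bil_bas, vec]
  simp only [curv]
  rw [← Finset.sum_sub_distrib, ← Finset.sum_add_distrib, ← Finset.sum_sub_distrib]
  refine Finset.sum_congr rfl fun S _ => ?_
  rw [← sub_smul, ← add_smul, ← sub_smul, Finset.sum_sub_distrib]
  congr 1
  ring

/-- The connection and its derivatives at a point satisfy the algebraic conditions. -/
theorem IsDarbouxTsarev.isFlatJet (h : IsDarbouxTsarev U X Γ) (hm : ∀ a, 1 ≤ m a)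
    (hU : IsOpen U) {u : Pt m} (hu : u ∈ U) :
    IsFlatJet (bil fun I J K => Γ I J K u) (dbil Γ u) where
  norm := h.bil_normalized hm hU hu
  dnorm := dbil_mem (N := normalized (Alg m)) hU h.smooth_Γ
    (fun _ hv => h.bil_normalized hm hU hv) hu
  curv x y z w := by
    set H := bil fun I J K => Γ I J K u with hH
    set dH := dbil Γ u
    have key : ∀ K I L P : BIdx m, curvOf H dH (bas K) (bas I) (bas L) * bas P
        + curvOf H dH (bas I) (bas P) (bas L) * bas K
        + curvOf H dH (bas P) (bas K) (bas L) * bas I = 0 := by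
      intro K I L P
      simp only [hH, dH, sum_curv, vec_mul_bas]
      rw [← Finset.sum_add_distrib, ← Finset.sum_add_distrib]
      refine Finset.sum_eq_zero fun J _ => ?_
      rw [← add_smul, ← add_smul, ← Finset.sum_add_distrib, ← Finset.sum_add_distrib]
      have := h.curvature u hu J L K I P
      simp only [mul_comm (sc _ _ _)]
      rw [this, zero_smul]
    -- Linearity in each of the four arguments in turn reduces the identity to basis vectors.
    have lin4 : ∀ f : Alg m → Alg m → Alg m → Alg m → Alg m,
        f = (fun x y z w => curvOf H dH x y z * w + curvOf H dH y w z * x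
          + curvOf H dH w x z * y) → f x y z w = 0 := by
      intro f hf
      refine eq_zero_of_bas (f := fun x => f x y z w) ⟨?_, ?_⟩ (fun K => ?_) x
      · intro x x'
        simp only [hf, curvOf, map_add, LinearMap.add_apply]; ring
      · intro c x
        simp only [hf, curvOf, map_smul, LinearMap.smul_apply]
        simp only [Algebra.smul_def]; ring
      refine eq_zero_of_bas (f := fun y => f (bas K) y z w) ⟨?_, ?_⟩ (fun I => ?_) y
      · intro x x'
        simp only [hf, curvOf, map_add, LinearMap.add_apply]; ring
      · intro c x
        simp only [hf, curvOf, map_smul, LinearMap.smul_apply]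
        simp only [Algebra.smul_def]; ring
      refine eq_zero_of_bas (f := fun z => f (bas K) (bas I) z w) ⟨?_, ?_⟩ (fun L => ?_) z
      · intro x x'
        simp only [hf, curvOf, map_add]; ring
      · intro c x
        simp only [hf, curvOf, map_smul]
        simp only [Algebra.smul_def]; ring
      refine eq_zero_of_bas (f := fun w => f (bas K) (bas I) (bas L) w) ⟨?_, ?_⟩ (fun P => ?_) w
      · intro x x'
        simp only [hf, curvOf, map_add, LinearMap.add_apply]; ring
      · intro c x
        simp only [hf, curvOf, map_smul, LinearMap.smul_apply]
        simp only [Algebra.smul_def]; ring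
      rw [hf]
      exact key K I L P
    exact lin4 _ rfl

theorem IsDarbouxTsarev.dbil_filtered (h : IsDarbouxTsarev U X Γ) (hm : ∀ a, 1 ≤ m a)
    (hU : IsOpen U) {u : Pt m} (hu : u ∈ U) (x : Alg m) : dbil Γ u x ∈ filtered m :=
  dbil_mem hU h.smooth_Γ (fun _ hv => h.bil_filtered hm hU hv) hu x

end Connection

/-! ### The right-hand sides and their total derivatives -/

section System

open Module

variable {r : ℕ} {m : Fin r → ℕ}

/-- The right-hand side with numerical Christoffel symbols. -/
def rhsAt (g : Tup m) (J I : BIdx m) (v : BIdx m → ℝ) (p : BIdx m → BIdx m → ℝ) : ℝ :=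
  rhs (fun I J K _ => g I J K) J I 0 v p

theorem hasDerivAt_comp {f : ℝ → BIdx m → ℝ} {f' : BIdx m → ℝ} {t : ℝ}
    (h : ∀ I, HasDerivAt (fun s => f s I) (f' I) t) (a : Fin r) (i : ℕ) :
    HasDerivAt (fun s => comp (f s) a i) (comp f' a i) t := by
  unfold comp
  by_cases hi : i ∈ Finset.Icc 1 (m a)
  · simp only [dif_pos hi]; exact h _
  · simp only [dif_neg hi]; exact hasDerivAt_const _ _

theorem hasDerivAt_chr {Γ : BIdx m → BIdx m → BIdx m → Pt m → ℝ} {u : Pt m}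
    (hd : ∀ I J K, DifferentiableAt ℝ (Γ I J K) u) (L : BIdx m) (a : Fin r) (i : ℕ) (b : Fin r)
    (j : ℕ) (c : Fin r) (k : ℕ) :
    HasDerivAt (fun t : ℝ => chr Γ (u + t • Pi.single L 1) a i b j c k)
      (chr (fun I J K _ => pd L (Γ I J K) u) 0 a i b j c k) 0 := by
  refine hasDerivAt_comp (fun I => hasDerivAt_comp (fun J => hasDerivAt_comp (fun K => ?_) _ _) _ _)
    _ _
  have h1 : HasDerivAt (fun t : ℝ => u + t • (Pi.single L 1 : Pt m)) (Pi.single L 1) 0 := by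
    simpa using ((hasDerivAt_id (0 : ℝ)).smul_const (Pi.single L 1 : Pt m)).const_add u
  have h2 : HasFDerivAt (Γ I J K) (fderiv ℝ (Γ I J K) u) (u + (0 : ℝ) • (Pi.single L 1 : Pt m)) := by
    simpa using (hd I J K).hasFDerivAt
  exact h2.comp_hasDerivAt (0 : ℝ) h1

/-- The right-hand side is linear in `p` with constant coefficients, plus a term bilinear in `Γ` and
`v`. So `q L` solves the same system with values `p L` and a source built from `∂_L Γ` and `v`; one
analysis then serves both orders of the jet. -/
theorem totalDeriv_rhs {Γ : BIdx m → BIdx m → BIdx m → Pt m → ℝ} {u : Pt m}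
    (hd : ∀ I J K, DifferentiableAt ℝ (Γ I J K) u) (J I L : BIdx m) (v : BIdx m → ℝ)
    (p : BIdx m → BIdx m → ℝ) (q : BIdx m → BIdx m → BIdx m → ℝ) :
    totalDeriv (rhs Γ J I) L u v p q
      = rhsAt (fun I J K => Γ I J K u) J I (p L) (q L)
        + rhsAt (fun I J K => pd L (Γ I J K) u) J I v 0 := by
  have hΓ := fun a i b j c k => hasDerivAt_chr hd L a i b j c k
  have hv : ∀ a i, HasDerivAt (fun t : ℝ => comp (fun I => v I + t * p L I) a i)
      (comp (p L) a i) 0 := fun a i => by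
    refine hasDerivAt_comp (fun I => ?_) a i
    simpa using ((hasDerivAt_id (0 : ℝ)).mul_const (p L I)).const_add (v I)
  have hp : ∀ b j a i, HasDerivAt (fun t : ℝ => dθ (fun J I => p J I + t * q L J I) b j a i)
      (dθ (q L) b j a i) 0 := fun b j a i => by
    refine hasDerivAt_comp (fun J => hasDerivAt_comp (fun I => ?_) a i) b j
    simpa using ((hasDerivAt_id (0 : ℝ)).mul_const (q L J I)).const_add (p J I)
  have h0 : ∀ b j a i, dθ (0 : BIdx m → BIdx m → ℝ) b j a i = 0 := by
    intro b j a i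
    simp [dθ, comp]
  have hz : u + (0 : ℝ) • (Pi.single L 1 : Pt m) = u := by simp
  have hchr : ∀ a i b j c k, chr Γ u a i b j c k
      = chr (fun I J K _ => Γ I J K u) 0 a i b j c k := fun _ _ _ _ _ _ => rfl
  have hv0 : (fun I => v I + 0 * p L I) = v := by funext I; simp
  rw [totalDeriv]
  refine HasDerivAt.deriv ?_
  unfold rhs rhsAt rhs
  simp only
  split_ifs with h1 h2 h3 h4
  · simpa using hasDerivAt_const (0 : ℝ) (0 : ℝ)
  · have hs := HasDerivAt.fun_sum (u := Finset.Icc 2 (m I.1))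
      fun k _ => hΓ I.1 k I.1 2 I.1 k
    have := (hs.const_mul (2 / (m I.1 : ℝ))).mul (hv I.1 (m I.1))
    simp only [hz, hv0] at this
    refine this.congr_deriv ?_
    simp only [hchr]
    ring
  · have hs := HasDerivAt.fun_sum (u := Finset.Icc ((J.2 : ℕ) - 1) (m I.1 + 1 - I.2))
      fun s _ => ((hΓ I.1 (s + 1 - J.2) I.1 1 I.1 1).sub (hΓ I.1 s I.1 2 I.1 (J.2 - 1))).mul
        (hv I.1 (I.2 + s - 1))
    have := (((hp I.1 (J.2 - 1) I.1 (I.2 + 1)).add (hp I.1 2 I.1 (I.2 + J.2 - 2))).sub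
      (hp I.1 1 I.1 (I.2 + J.2 - 1))).add (hs.const_mul 2)
    simp only [Pi.sub_apply, hz, hv0] at this
    refine this.congr_deriv ?_
    simp only [hchr, h0, Finset.sum_add_distrib]
    ring
  · simpa using hasDerivAt_const (0 : ℝ) (0 : ℝ)
  · have hs := HasDerivAt.fun_sum (u := Finset.Icc (J.2 : ℕ) (m I.1 + 1 - I.2))
      fun s _ => (hΓ I.1 s J.1 J.2 I.1 1).mul (hv I.1 (s + I.2 - 1))
    have := hs.const_mul 2
    simp only [hz, hv0] at this
    refine this.congr_deriv ?_
    simp only [hchr, Finset.sum_add_distrib]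
    ring

/-! ### Covectors as elements of the algebra -/

/-- The element of the block `a` that represents the covector with components `f 1, …, f m_a`. -/
def rep (a : Fin r) : (ℕ → ℝ) →ₗ[ℝ] Alg m where
  toFun f := ∑ k ∈ Finset.range (m a), f (k + 1) • (idem a * nil a ^ (m a - 1 - k))
  map_add' f g := by simp [add_smul, Finset.sum_add_distrib]
  map_smul' c f := by simp [mul_smul, Finset.smul_sum]

theorem rep_apply (a : Fin r) (f : ℕ → ℝ) : (rep a f : Alg m)
    = ∑ k ∈ Finset.range (m a), f (k + 1) • (idem a * nil a ^ (m a - 1 - k)) := rfl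

theorem rep_congr {a : Fin r} {f g : ℕ → ℝ} (h : ∀ i, 1 ≤ i → i ≤ m a → f i = g i) :
    (rep a f : Alg m) = rep a g := by
  rw [rep_apply, rep_apply]
  refine Finset.sum_congr rfl fun k hk => ?_
  rw [Finset.mem_range] at hk
  rw [h (k + 1) (by omega) (by omega)]

theorem idem_mul_rep (a : Fin r) (f : ℕ → ℝ) : idem a * (rep a f : Alg m) = rep a f := by
  rw [rep_apply, Finset.mul_sum]
  refine Finset.sum_congr rfl fun k _ => ?_
  rw [mul_smul_comm, ← mul_assoc, idem_mul_self]

/-- The exponents in `rep` are reversed so that multiplication by `ε` becomes the index shift, the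
transpose of its action on vectors. Via `mul_rep` this turns the sums of the system into products in
the algebra. -/
theorem nil_mul_rep {a : Fin r} {f : ℕ → ℝ} (hf : f (m a + 1) = 0) :
    nil a * (rep a f : Alg m) = rep a fun i => f (i + 1) := by
  rw [rep_apply, rep_apply]
  rcases Nat.eq_zero_or_pos (m a) with h | h
  · simp [h]
  obtain ⟨n, hn⟩ := Nat.exists_eq_add_of_le' h
  have e2 : Finset.range (m a) = Finset.range (n + 1) := by rw [hn]
  rw [e2, Finset.sum_range_succ', Finset.sum_range_succ, mul_add, Finset.mul_sum]
  have h1 : f (n + 1 + 1) = 0 := by rw [← hn]; exact hf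
  rw [h1, zero_smul, add_zero, mul_smul_comm]
  have h2 : nil a * ((idem a : Alg m) * nil a ^ (m a - 1 - 0)) = 0 := by
    rw [mul_left_comm, ← pow_succ', idem_mul_pow_eq_zero a (by omega)]
  rw [h2, smul_zero, add_zero]
  refine Finset.sum_congr rfl fun k hk => ?_
  rw [Finset.mem_range] at hk
  rw [mul_smul_comm, mul_left_comm, ← pow_succ', show m a - 1 - (k + 1) + 1 = m a - 1 - k by omega]

theorem nil_pow_mul_rep {a : Fin r} {f : ℕ → ℝ} (hf : ∀ i, m a < i → f i = 0) (k : ℕ) :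
    nil a ^ k * (rep a f : Alg m) = rep a fun i => f (i + k) := by
  induction k with
  | zero => simp
  | succ k ih =>
    rw [pow_succ', mul_assoc, ih, nil_mul_rep (by exact hf _ (by omega))]
    refine rep_congr fun i _ _ => ?_
    congr 1; omega

theorem eq_zero_of_rep {a : Fin r} {f : ℕ → ℝ} (h : (rep a f : Alg m) = 0) {i : ℕ} (h1 : 1 ≤ i)
    (hi : i ≤ m a) : f i = 0 := by
  have h2 := congrArg (fun x => bas.repr x
    (⟨a, m a - i + 1, Finset.mem_Icc.2 (by omega)⟩ : BIdx m)) h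
  simp only [rep_apply, map_sum, Finsupp.coe_finsetSum, Finset.sum_apply, map_zero,
    Finsupp.zero_apply] at h2
  rw [Finset.sum_eq_single (i - 1)] at h2
  · rw [show m a - 1 - (i - 1) = m a - i by omega,
      ← bas_mk a (m a - i) (Finset.mem_Icc.2 (by omega)), show i - 1 + 1 = i by omega] at h2
    simpa using h2
  · intro k hk hne
    rw [Finset.mem_range] at hk
    rw [← bas_mk a (m a - 1 - k) (Finset.mem_Icc.2 (by omega)), map_smul, Basis.repr_self,
      Finsupp.smul_apply, Finsupp.single_apply, if_neg, smul_zero]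
    intro heq
    have : m a - 1 - k + 1 = m a - i + 1 := by
      simpa using heq
    omega
  · intro hk
    rw [Finset.mem_range] at hk
    omega

theorem mul_rep (a : Fin r) (y : Alg m) {f : ℕ → ℝ} (hf : ∀ i, m a < i → f i = 0) :
    y * rep a f = rep a fun i => ∑ k ∈ Finset.range (m a), comp (bas.repr y) a (k + 1) * f (i + k) := by
  have h1 : y * rep a f = (idem a * y) * rep a f := by
    linear_combination (-y) * idem_mul_rep (m := m) a f
  rw [h1]
  nth_rewrite 1 [← bas.sum_repr y]
  rw [idem_mul_sum, Finset.sum_mul]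
  have h2 : ∀ k, (comp (bas.repr y) a (k + 1) • ((idem a : Alg m) * nil a ^ k)) * rep a f
      = rep a (comp (bas.repr y) a (k + 1) • fun i => f (i + k)) := by
    intro k
    rw [map_smul, ← nil_pow_mul_rep hf, smul_mul_assoc]
    congr 1
    linear_combination nil a ^ k * idem_mul_rep (m := m) a f
  rw [Finset.sum_congr rfl fun k _ => h2 k, ← map_sum]
  congr 1
  funext i
  simp [Finset.sum_apply]

end System

/-! ### The system in terms of the algebra -/

section Conversion

open Module

variable {r : ℕ} {m : Fin r → ℕ}

theorem repr_bil (g : Tup m) (I J K : BIdx m) :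
    bas.repr (bil g (bas J) (bas K)) I = g I J K := by
  rw [bil_bas, Basis.repr_sum_self]

theorem chr_eq (g : Tup m) (a : Fin r) (s : ℕ) (J K : BIdx m) :
    chr (fun I J K _ => g I J K) 0 a s J.1 J.2 K.1 K.2
      = comp (bas.repr (bil g (bas J) (bas K))) a s := by
  unfold chr
  congr 1
  funext I
  rw [comp_mk, comp_mk, repr_bil]

theorem comp_eq_zero {f : BIdx m → ℝ} {a : Fin r} {i : ℕ} (h : i = 0 ∨ m a < i) :
    comp f a i = 0 := by
  rw [comp, dif_neg]
  rw [Finset.mem_Icc]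
  omega

theorem comp_repr_eq_zero {y : Alg m} {k : ℕ} (hy : y ∈ fil m k) (a : Fin r) {s : ℕ}
    (hs : s ≤ k) : comp (bas.repr y) a s = 0 := by
  unfold comp
  split_ifs with h
  · exact repr_of_mem_fil hy hs
  · rfl

theorem sum_Icc_eq_sum_range {F : ℕ → ℝ} {p M t n : ℕ}
    (h1 : ∀ s, p ≤ s → s ≤ M → (s < t ∨ n + t ≤ s) → F s = 0)
    (h2 : ∀ s, t ≤ s → s < n + t → (s < p ∨ M < s) → F s = 0) :
    ∑ s ∈ Finset.Icc p M, F s = ∑ k ∈ Finset.range n, F (k + t) := by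
  have e : ∑ k ∈ Finset.range n, F (k + t) = ∑ s ∈ Finset.Ico t (n + t), F s := by
    rw [Finset.range_eq_Ico, Finset.sum_Ico_add' F 0 n t, zero_add]
  rw [e]
  refine (Finset.sum_subset (Finset.subset_union_left (s₂ := Finset.Ico t (n + t))) ?_).trans
    (Finset.sum_subset (Finset.subset_union_right (s₁ := Finset.Icc p M)) ?_).symm
  · intro s hs hs'
    simp only [Finset.mem_union, Finset.mem_Icc, Finset.mem_Ico] at hs hs'
    exact h2 s (by omega) (by omega) (by omega)
  · intro s hs hs'
    simp only [Finset.mem_union, Finset.mem_Icc, Finset.mem_Ico] at hs hs'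
    exact h1 s (by omega) (by omega) (by omega)

theorem bas_one (a : Fin r) (h : 1 ∈ Finset.Icc 1 (m a)) : (bas ⟨a, 1, h⟩ : Alg m) = idem a := by
  rw [bas_apply]; simp

theorem bas_two (a : Fin r) (h : 2 ∈ Finset.Icc 1 (m a)) : (bas ⟨a, 2, h⟩ : Alg m) = nil a := by
  rw [bas_apply]; simp [idem_mul_nil]

/-- The summation limits are redundant: below `s = j` the symbols vanish by the filtration, above
`m_α - i + 1` the unknowns lie outside the block. The equations with right-hand side `0` are the
case of an empty range. -/
theorem rhsAt_of_ne {g : Tup m} (hg : bil g ∈ filtered m) {J I : BIdx m} (h : J.1 ≠ I.1)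
    (v : BIdx m → ℝ) (p : BIdx m → BIdx m → ℝ) :
    rhsAt g J I v p = 2 * ∑ k ∈ Finset.range (m I.1),
      comp (bas.repr (bil g (bas J) (idem I.1))) I.1 (k + 1) * comp v I.1 (I.2 + k) := by
  have hJ := mem_pos (I := J)
  have hI := mem_pos (I := I)
  have h1 : 1 ∈ Finset.Icc 1 (m I.1) := by rw [Finset.mem_Icc]; omega
  have hc : ∀ s, chr (fun I J K _ => g I J K) 0 I.1 s J.1 J.2 I.1 1
      = comp (bas.repr (bil g (bas J) (idem I.1))) I.1 s := by
    intro s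
    rw [← bas_one I.1 h1]
    exact chr_eq g I.1 s J ⟨I.1, 1, h1⟩
  have hz : ∀ s < (J.2 : ℕ), comp (bas.repr (bil g (bas J) (idem I.1))) I.1 s = 0 := by
    intro s hs
    exact comp_repr_eq_zero (hg (J.2 - 1) _ (bas_mem_fil (by omega)) _) _ (by omega)
  have hsum := sum_Icc_eq_sum_range (p := J.2) (M := m I.1 + 1 - I.2) (t := 1) (n := m I.1)
    (F := fun s => comp (bas.repr (bil g (bas J) (idem I.1))) I.1 s * comp v I.1 (s + I.2 - 1))
    (fun s _ _ _ => by omega)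
    (fun s _ _ hs => by
      rcases hs with hs | hs
      · rw [hz s hs, zero_mul]
      · rw [comp_eq_zero (f := v) (Or.inr (by omega)), mul_zero])
  have hsum' : ∑ k ∈ Finset.range (m I.1), comp (bas.repr (bil g (bas J) (idem I.1))) I.1 (k + 1)
        * comp v I.1 (I.2 + k)
      = ∑ s ∈ Finset.Icc (J.2 : ℕ) (m I.1 + 1 - I.2),
        comp (bas.repr (bil g (bas J) (idem I.1))) I.1 s * comp v I.1 (s + I.2 - 1) := by
    rw [hsum]
    refine Finset.sum_congr rfl fun k _ => ?_
    rw [show k + 1 + (I.2 : ℕ) - 1 = I.2 + k by omega]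
  rw [hsum', rhsAt, rhs]
  simp only [if_neg h, hc]
  split_ifs with h2
  · rw [Finset.Icc_eq_empty (by omega)]; simp
  · rfl

/-- The part of the right-hand side within a block that contains the unknowns. -/
def inhom (g : Tup m) (a : Fin r) (n i : ℕ) (v : BIdx m → ℝ) : ℝ :=
  2 * (∑ k ∈ Finset.range (m a),
      comp (bas.repr (bil g (idem a) (idem a))) a (k + 1) * comp v a (i + k + n)
    - ∑ k ∈ Finset.range (m a),
      comp (bas.repr (bil g (nil a) (idem a * nil a ^ (n - 1)))) a (k + 1) * comp v a (i + k))

theorem rhsAt_of_eq {g : Tup m} (hg : bil g ∈ filtered m) (hs : ∀ x y, bil g x y = bil g y x)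
    {a : Fin r} {j i : ℕ} (hj : j ∈ Finset.Icc 1 (m a)) (hi : i ∈ Finset.Icc 1 (m a))
    (h3 : 3 ≤ j) (v : BIdx m → ℝ) (p : BIdx m → BIdx m → ℝ) :
    rhsAt g ⟨a, j, hj⟩ ⟨a, i, hi⟩ v p = (if m a + 3 ≤ i + j then 0 else
      dθ p a (j - 1) a (i + 1) + dθ p a 2 a (i + j - 2) - dθ p a 1 a (i + j - 1))
      + inhom g a (j - 1) i v := by
  have hj' := Finset.mem_Icc.1 hj
  have hi' := Finset.mem_Icc.1 hi
  have m1 : 1 ∈ Finset.Icc 1 (m a) := by rw [Finset.mem_Icc]; omega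
  have m2 : 2 ∈ Finset.Icc 1 (m a) := by rw [Finset.mem_Icc]; omega
  have mj : j - 2 + 1 ∈ Finset.Icc 1 (m a) := by rw [Finset.mem_Icc]; omega
  have hc1 : ∀ s, chr (fun I J K _ => g I J K) 0 a s a 1 a 1
      = comp (bas.repr (bil g (idem a) (idem a))) a s := by
    intro s
    rw [← bas_one a m1]
    exact chr_eq g a s ⟨a, 1, m1⟩ ⟨a, 1, m1⟩
  have hc2 : ∀ s, chr (fun I J K _ => g I J K) 0 a s a 2 a (j - 1)
      = comp (bas.repr (bil g (nil a) (idem a * nil a ^ (j - 2)))) a s := by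
    intro s
    rw [← bas_mk a _ mj, ← bas_two a m2, show j - 1 = j - 2 + 1 by omega]
    exact chr_eq g a s ⟨a, 2, m2⟩ ⟨a, j - 2 + 1, mj⟩
  have hz : ∀ s < j - 1, comp (bas.repr (bil g (nil a) (idem a * nil a ^ (j - 2)))) a s = 0 := by
    intro s hs'
    rw [hs, ← bas_mk a _ mj]
    exact comp_repr_eq_zero (hg (j - 2) _ (bas_mem_fil (by simp)) _) _ (by omega)
  have s1 := sum_Icc_eq_sum_range (p := j - 1) (M := m a + 1 - i) (t := j) (n := m a)
    (F := fun s => comp (bas.repr (bil g (idem a) (idem a))) a (s + 1 - j) * comp v a (i + s - 1))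
    (fun s _ _ hs => by
      rw [comp_eq_zero (f := bas.repr (bil g (idem a) (idem a))) (Or.inl (by omega)), zero_mul])
    (fun s _ _ hs => by
      rw [comp_eq_zero (f := v) (Or.inr (by omega)), mul_zero])
  have s2 := sum_Icc_eq_sum_range (p := j - 1) (M := m a + 1 - i) (t := 1) (n := m a)
    (F := fun s => comp (bas.repr (bil g (nil a) (idem a * nil a ^ (j - 2)))) a s
      * comp v a (i + s - 1))
    (fun s _ _ hs => by omega)
    (fun s _ _ hs => by
      rcases hs with hs | hs
      · rw [hz s hs, zero_mul]
      · rw [comp_eq_zero (f := v) (Or.inr (by omega)), mul_zero])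
  have e : inhom g a (j - 1) i v = 2 * ∑ s ∈ Finset.Icc (j - 1) (m a + 1 - i),
      (comp (bas.repr (bil g (idem a) (idem a))) a (s + 1 - j)
        - comp (bas.repr (bil g (nil a) (idem a * nil a ^ (j - 2)))) a s)
        * comp v a (i + s - 1) := by
    simp only [sub_mul, Finset.sum_sub_distrib]
    rw [s1, s2, inhom, show j - 1 - 1 = j - 2 by omega]
    congr 2
    · refine Finset.sum_congr rfl fun k _ => ?_
      rw [show k + j + 1 - j = k + 1 by omega, show i + (k + j) - 1 = i + k + (j - 1) by omega]
  rw [e, rhsAt, rhs]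
  simp only [if_true, hc1, hc2, if_neg (show ¬ j = 2 by omega)]
  split_ifs with h2
  · rw [Finset.Icc_eq_empty (by omega)]; simp
  · rfl

variable {g₁ g₂ : Tup m} {v₁ v₂ : BIdx m → ℝ} {P : BIdx m → BIdx m → ℝ}

/-- `P` solves the system with coefficients `g₁`, values `v₁` and the source given by `g₂`, `v₂`. -/
structure IsSolutionWithSource (g₁ g₂ : Tup m) (v₁ v₂ : BIdx m → ℝ)
    (P : BIdx m → BIdx m → ℝ) : Prop where
  filt₁ : bil g₁ ∈ filtered m
  filt₂ : bil g₂ ∈ filtered m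
  norm₁ : IsNormalized (bil g₁)
  norm₂ : IsNormalized (bil g₂)
  eqn : ∀ J I, Prescribed J I → P J I = rhsAt g₁ J I v₁ P + rhsAt g₂ J I v₂ 0

/-- The covector `v` restricted to a block. -/
abbrev repv (a : Fin r) (v : BIdx m → ℝ) : Alg m := rep a (comp v a)

theorem mul_repv (a : Fin r) (y : Alg m) (v : BIdx m → ℝ) : y * repv a v
    = rep a fun i => ∑ k ∈ Finset.range (m a), comp (bas.repr y) a (k + 1) * comp v a (i + k) :=
  mul_rep a y fun _ hi => comp_eq_zero (Or.inr hi)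

theorem IsSolutionWithSource.transverse (h : IsSolutionWithSource g₁ g₂ v₁ v₂ P) {J : BIdx m}
    {a : Fin r} (hJ : J.1 ≠ a) :
    repv a (P J) = 2 * bil g₁ (bas J) (idem a) * repv a v₁
      + 2 * bil g₂ (bas J) (idem a) * repv a v₂ := by
  rw [mul_assoc, mul_assoc, mul_repv, mul_repv, ← mul_add, ← map_add,
    show (2 : Alg m) = algebraMap ℝ _ 2 from (map_ofNat _ 2).symm, ← Algebra.smul_def, ← map_smul]
  refine rep_congr fun i h1 hi => ?_
  have hi' : i ∈ Finset.Icc 1 (m a) := Finset.mem_Icc.2 ⟨h1, hi⟩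
  rw [comp_mk (P J) a ⟨i, hi'⟩, h.eqn J ⟨a, i, hi'⟩ (Or.inl hJ),
    rhsAt_of_ne h.filt₁ (by exact hJ), rhsAt_of_ne h.filt₂ (by exact hJ)]
  simp [mul_add]

/-- The derivatives `∂_{(n + 1)(a)} θ` within the block `a`. -/
def blk (P : BIdx m → BIdx m → ℝ) (a : Fin r) (n : ℕ) : Alg m :=
  rep a fun i => dθ P a (n + 1) a i

theorem blk_eq_repv {P : BIdx m → BIdx m → ℝ} {a : Fin r} {n : ℕ}
    (h : n + 1 ∈ Finset.Icc 1 (m a)) : blk P a n = repv a (P ⟨a, n + 1, h⟩) := by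
  refine rep_congr fun i _ _ => ?_
  exact comp_mk (fun J => comp (fun I => P J I) a i) a ⟨n + 1, h⟩

theorem blk_eq_zero {P : BIdx m → BIdx m → ℝ} {a : Fin r} {n : ℕ} (h : m a ≤ n) :
    blk P a n = 0 := by
  rw [blk, ← map_zero (rep a)]
  refine rep_congr fun i _ _ => ?_
  exact comp_eq_zero (Or.inr (by omega))

theorem dθ_eq_zero {P : BIdx m → BIdx m → ℝ} {a b : Fin r} {j i : ℕ} (h : m a < i) :
    dθ P b j a i = 0 := by
  unfold dθ
  have : (fun J => comp (fun I => P J I) a i) = fun _ => 0 := by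
    funext J
    exact comp_eq_zero (Or.inr h)
  rw [this, comp]
  split_ifs <;> rfl

theorem dθ_mk {P : BIdx m → BIdx m → ℝ} {a b : Fin r} {j i : ℕ} (hj : j ∈ Finset.Icc 1 (m b))
    (hi : i ∈ Finset.Icc 1 (m a)) : dθ P b j a i = P ⟨b, j, hj⟩ ⟨a, i, hi⟩ := by
  unfold dθ
  rw [comp_mk _ b ⟨j, hj⟩, comp_mk _ a ⟨i, hi⟩]

theorem dθ_zero (b : Fin r) (j : ℕ) (a : Fin r) (i : ℕ) :
    dθ (0 : BIdx m → BIdx m → ℝ) b j a i = 0 := by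
  simp [dθ, comp]

/-- The vanishing equations for `i + j ≥ m_α + 3` are instances of the general recursion, because
each derivative on its right side is then zero as well. -/
theorem IsSolutionWithSource.dθ_eq (h : IsSolutionWithSource g₁ g₂ v₁ v₂ P) {a : Fin r} {j i : ℕ}
    (h3 : 3 ≤ j) (hj : j ≤ m a) (h1 : 1 ≤ i) (hi : i ≤ m a) :
    dθ P a j a i = dθ P a (j - 1) a (i + 1) + dθ P a 2 a (i + j - 2) - dθ P a 1 a (i + j - 1)
      + inhom g₁ a (j - 1) i v₁ + inhom g₂ a (j - 1) i v₂ := by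
  have key : ∀ j i, 3 ≤ j → j ≤ m a → 1 ≤ i → i ≤ m a → dθ P a j a i =
      (if m a + 3 ≤ i + j then 0 else
      dθ P a (j - 1) a (i + 1) + dθ P a 2 a (i + j - 2) - dθ P a 1 a (i + j - 1))
      + inhom g₁ a (j - 1) i v₁ + inhom g₂ a (j - 1) i v₂ := by
    intro j i h3 hj h1 hi
    have mj : j ∈ Finset.Icc 1 (m a) := by rw [Finset.mem_Icc]; omega
    have mi : i ∈ Finset.Icc 1 (m a) := by rw [Finset.mem_Icc]; omega
    rw [dθ_mk mj mi, h.eqn _ _ (Or.inr (Or.inl h3)), rhsAt_of_eq h.filt₁ h.norm₁.symm mj mi h3,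
      rhsAt_of_eq h.filt₂ h.norm₂.symm mj mi h3]
    simp only [dθ_zero]
    simp [add_assoc]
  have hzero : ∀ j i, 3 ≤ j → j ≤ m a → 1 ≤ i → i ≤ m a → m a + 3 ≤ i + j → dθ P a j a i = 0 := by
    intro j i h3 hj h1 hi hij
    have mj : j ∈ Finset.Icc 1 (m a) := by rw [Finset.mem_Icc]; omega
    have mi : i ∈ Finset.Icc 1 (m a) := by rw [Finset.mem_Icc]; omega
    rw [dθ_mk mj mi, h.eqn _ _ (Or.inr (Or.inl h3)), rhsAt, rhsAt, rhs, rhs]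
    simp [hij]
  rw [key j i h3 hj h1 hi]
  split_ifs with hij
  · rw [dθ_eq_zero (show m a < i + j - 2 by omega), dθ_eq_zero (show m a < i + j - 1 by omega)]
    rcases Nat.lt_or_ge (m a) (i + 1) with h4 | h4
    · rw [dθ_eq_zero h4]; ring
    · rw [hzero (j - 1) (i + 1) (by omega) (by omega) (by omega) h4 (by omega)]; ring
  · rfl

theorem rep_inhom {g : Tup m} (a : Fin r) {n : ℕ} (hn : 1 ≤ n) (v : BIdx m → ℝ) :
    (rep a fun i => inhom g a n i v)
      = -2 * blockPart (idem a) (bil g) (nil a) (nil a ^ (n - 1)) * repv a v := by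
  have h1 := mul_repv a (bil g (idem a) (idem a)) v
  have h2 := mul_repv a (bil g (nil a) (idem a * nil a ^ (n - 1))) v
  have h3 := nil_pow_mul_rep (m := m) (a := a) (f := fun i => ∑ k ∈ Finset.range (m a),
    comp (bas.repr (bil g (idem a) (idem a))) a (k + 1) * comp v a (i + k))
    (fun i hi => Finset.sum_eq_zero fun k _ => by
      rw [comp_eq_zero (f := v) (Or.inr (by omega)), mul_zero]) n
  have h4 : (rep a fun i => inhom g a n i v : Alg m) = (2 : ℝ) •
      ((rep a fun i => ∑ k ∈ Finset.range (m a),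
        comp (bas.repr (bil g (idem a) (idem a))) a (k + 1) * comp v a (i + n + k))
      - rep a fun i => ∑ k ∈ Finset.range (m a),
        comp (bas.repr (bil g (nil a) (idem a * nil a ^ (n - 1)))) a (k + 1)
          * comp v a (i + k)) := by
    rw [← map_sub, ← map_smul]
    refine rep_congr fun i _ _ => ?_
    simp only [inhom, Pi.smul_apply, Pi.sub_apply, smul_eq_mul]
    simp only [add_right_comm i]
  rw [h4, ← h3, ← h1, ← h2, blockPart_apply, Algebra.smul_def, idem_mul_nil]
  have h5 : nil a * (nil a : Alg m) ^ (n - 1) = nil a ^ n := by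
    rw [← pow_succ']; congr 1; omega
  have h6 := idem_mul_rep (m := m) a (comp v a)
  simp only [map_ofNat]
  linear_combination (2 * bil g (nil a) (idem a * nil a ^ (n - 1))
    - 2 * nil a ^ n * bil g (idem a) (idem a)) * h6
    - 2 * idem a * bil g (idem a) (idem a) * rep a (comp v a) * h5

theorem idem_mul_mul_nil_pow {x : Alg m} {n : ℕ} (hx : x ∈ fil m n) (a : Fin r) (hn : n < m a) :
    idem a * x * nil a ^ (m a - 1 - n)
      = comp (bas.repr x) a (n + 1) • (idem a * nil a ^ (m a - 1)) := by
  nth_rewrite 1 [← bas.sum_repr x]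
  rw [idem_mul_sum, Finset.sum_mul, Finset.sum_eq_single n]
  · rw [smul_mul_assoc, mul_assoc, ← pow_add, show n + (m a - 1 - n) = m a - 1 by omega]
  · intro k hk hne
    rcases Nat.lt_or_gt_of_ne hne with h | h
    · rw [comp_repr_eq_zero hx a (by omega), zero_smul, zero_mul]
    · rw [smul_mul_assoc, mul_assoc, ← pow_add, idem_mul_pow_eq_zero a (by omega), smul_zero]
  · intro h
    rw [Finset.mem_range] at h
    omega

/-- By the filtration `Γ(ε, ε^k)` starts at order `ε^k`, with coefficient `Γ^{k+1}_{2,k+1}`; the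
normalizing correction has order `k + 1` and dies. For `n = m_α` the sum is the coefficient in the
equation for `∂_2 θ_{m_α}`. -/
theorem nil_pow_mul_cobound {g : Tup m} (hg : bil g ∈ filtered m) (hN : IsNormalized (bil g))
    {a : Fin r} (ha : 2 ≤ m a) {n : ℕ} (hn : n ≤ m a) :
    idem a * nil a ^ (m a - n) * cobound (blockPart (idem a) (bil g)) (nil a) n
      = (∑ k ∈ Finset.Icc 2 n, chr (fun I J K _ => g I J K) 0 a k a 2 a k)
        • (idem a * nil a ^ (m a - 1)) := by
  induction n with
  | zero => simp [cobound]
  | succ n ih =>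
    have ih := ih (by omega)
    rcases Nat.eq_zero_or_pos n with h0 | h0
    · subst h0
      simp [cobound, (hN.blockPart (idem_mul_self a)).unit]
    · have m2 : 2 ∈ Finset.Icc 1 (m a) := by rw [Finset.mem_Icc]; omega
      have mn : n + 1 ∈ Finset.Icc 1 (m a) := by rw [Finset.mem_Icc]; omega
      have hmem : bil g (nil a) (idem a * nil a ^ n) ∈ fil m n := by
        rw [hN.symm, ← bas_mk a _ mn]
        exact hg n _ (bas_mem_fil (by simp)) _
      have h1 := idem_mul_mul_nil_pow hmem a (by omega)
      have h2 : comp (bas.repr (bil g (nil a) (idem a * nil a ^ n))) a (n + 1)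
          = chr (fun I J K _ => g I J K) 0 a (n + 1) a 2 a (n + 1) := by
        rw [← bas_mk a _ mn, ← bas_two a m2]
        exact (chr_eq g a (n + 1) ⟨a, 2, m2⟩ ⟨a, n + 1, mn⟩).symm
      rw [h2] at h1
      have h3 : nil a ^ (m a - n) = nil a ^ (m a - (n + 1)) * (nil a : Alg m) := by
        rw [← pow_succ]; congr 1; omega
      have h4 : (idem a : Alg m) * (nil a ^ (m a - (n + 1)) * nil a * nil a ^ n) = 0 := by
        rw [← pow_succ, ← pow_add]
        exact idem_mul_pow_eq_zero a (by omega)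
      rw [Finset.sum_Icc_succ_top (by omega), add_smul, ← ih, ← h1, h3, cobound, blockPart_apply,
        idem_mul_nil, show m a - 1 - n = m a - (n + 1) by omega]
      linear_combination (nil a ^ (m a - (n + 1)) * bil g (nil a) (idem a * nil a ^ n))
        * idem_mul_self (m := m) a - idem a * bil g (idem a) (idem a) * h4

theorem IsSolutionWithSource.blk_succ (h : IsSolutionWithSource g₁ g₂ v₁ v₂ P)
    {a : Fin r} {n : ℕ} (h1 : 2 ≤ n) (hn : n < m a) :
    blk P a n = nil a * blk P a (n - 1) + nil a ^ (n - 1) * blk P a 1 - nil a ^ n * blk P a 0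
      - 2 * blockPart (idem a) (bil g₁) (nil a) (nil a ^ (n - 1)) * repv a v₁
      - 2 * blockPart (idem a) (bil g₂) (nil a) (nil a ^ (n - 1)) * repv a v₂ := by
  have e1 := rep_inhom (g := g₁) a (show 1 ≤ n by omega) v₁
  have e2 := rep_inhom (g := g₂) a (show 1 ≤ n by omega) v₂
  have e3 : nil a * blk P a (n - 1) = rep a fun i => dθ P a (n - 1 + 1) a (i + 1) :=
    nil_mul_rep (dθ_eq_zero (by omega))
  have e4 : nil a ^ (n - 1) * blk P a 1 = rep a fun i => dθ P a (1 + 1) a (i + (n - 1)) :=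
    nil_pow_mul_rep (fun i hi => dθ_eq_zero hi) _
  have e5 : nil a ^ n * blk P a 0 = rep a fun i => dθ P a (0 + 1) a (i + n) :=
    nil_pow_mul_rep (fun i hi => dθ_eq_zero hi) _
  have e6 : blk P a n = rep a ((fun i => dθ P a (n - 1 + 1) a (i + 1))
      + (fun i => dθ P a (1 + 1) a (i + (n - 1))) - (fun i => dθ P a (0 + 1) a (i + n))
      + (fun i => inhom g₁ a n i v₁) + (fun i => inhom g₂ a n i v₂)) := by
    refine rep_congr fun i hi hi' => ?_
    simp only [Pi.add_apply, Pi.sub_apply]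
    rw [h.dθ_eq (show 3 ≤ n + 1 by omega) hn hi hi']
    rw [show n - 1 + 1 = n + 1 - 1 by omega, show i + (n + 1) - 2 = i + (n - 1) by omega,
      show i + (n + 1) - 1 = i + n by omega, show n + 1 - 1 = n by omega]
  rw [e6]
  simp only [map_add, map_sub]
  rw [← e3, ← e4, ← e5, e1, e2]
  ring

/-- The recursion `blk_succ` is unrolled; `cobound` accumulates its inhomogeneous terms. -/
theorem IsSolutionWithSource.blk_eq_of_lt (h : IsSolutionWithSource g₁ g₂ v₁ v₂ P)
    {a : Fin r} {n : ℕ} (h1 : 1 ≤ n) (hn : n < m a) :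
    blk P a n = (n : Alg m) * nil a ^ (n - 1) * blk P a 1
      - ((n : Alg m) - 1) * nil a ^ n * blk P a 0
      - 2 * cobound (blockPart (idem a) (bil g₁)) (nil a) n * repv a v₁
      - 2 * cobound (blockPart (idem a) (bil g₂)) (nil a) n * repv a v₂ := by
  induction n, h1 using Nat.le_induction with
  | base =>
    simp [cobound, (h.norm₁.blockPart (idem_mul_self a)).unit,
      (h.norm₂.blockPart (idem_mul_self a)).unit]
  | succ n h1 ih =>
    have e := h.blk_succ (show 2 ≤ n + 1 by omega) hn
    rw [Nat.add_sub_cancel, ih (by omega)] at e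
    have e2 : nil a * (nil a : Alg m) ^ (n - 1) = nil a ^ n := by
      rw [← pow_succ']; congr 1; omega
    rw [e, Nat.add_sub_cancel]
    simp only [cobound]
    push_cast
    linear_combination (n : Alg m) * blk P a 1 * e2

/-- The equation for `∂_2 θ_{m_α}`, whose factor `2 / m_α` is what makes it the closed form at `n =
m_α`. -/
theorem IsSolutionWithSource.blk_last (h : IsSolutionWithSource g₁ g₂ v₁ v₂ P)
    {a : Fin r} (ha : 2 ≤ m a) :
    (m a : Alg m) * nil a ^ (m a - 1) * blk P a 1
      = 2 * cobound (blockPart (idem a) (bil g₁)) (nil a) (m a) * repv a v₁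
        + 2 * cobound (blockPart (idem a) (bil g₂)) (nil a) (m a) * repv a v₂ := by
  have c1 := nil_pow_mul_cobound h.filt₁ h.norm₁ ha le_rfl
  have c2 := nil_pow_mul_cobound h.filt₂ h.norm₂ ha le_rfl
  rw [Nat.sub_self, pow_zero, mul_one] at c1 c2
  have m2 : 2 ∈ Finset.Icc 1 (m a) := by rw [Finset.mem_Icc]; omega
  have mm : m a ∈ Finset.Icc 1 (m a) := by rw [Finset.mem_Icc]; omega
  have heq := h.eqn ⟨a, 2, m2⟩ ⟨a, m a, mm⟩ (Or.inr (Or.inr ⟨rfl, rfl⟩))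
  rw [← dθ_mk (P := P) m2 mm, rhsAt, rhsAt, rhs, rhs] at heq
  simp only [if_true, if_neg (show ¬ m a + 3 ≤ m a + 2 by omega)] at heq
  set S₁ := ∑ k ∈ Finset.Icc 2 (m a), chr (fun I J K _ => g₁ I J K) 0 a k a 2 a k
  set S₂ := ∑ k ∈ Finset.Icc 2 (m a), chr (fun I J K _ => g₂ I J K) 0 a k a 2 a k
  have e4 : nil a ^ (m a - 1) * blk P a 1 = rep a fun i => dθ P a (1 + 1) a (i + (m a - 1)) :=
    nil_pow_mul_rep (fun i hi => dθ_eq_zero hi) _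
  have e5 : ∀ v : BIdx m → ℝ, nil a ^ (m a - 1) * repv a v = rep a fun i => comp v a (i + (m a - 1)) :=
    fun v => nil_pow_mul_rep (fun i hi => comp_eq_zero (Or.inr hi)) _
  have e6 : (m a : ℝ) • (nil a ^ (m a - 1) * blk P a 1) = (2 : ℝ) •
      (S₁ • (nil a ^ (m a - 1) * repv a v₁) + S₂ • (nil a ^ (m a - 1) * repv a v₂)) := by
    rw [e4, e5, e5, ← map_smul, ← map_smul, ← map_smul, ← map_add, ← map_smul]
    refine rep_congr fun i hi hi' => ?_
    simp only [Pi.smul_apply, Pi.add_apply, smul_eq_mul]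
    rcases Nat.lt_or_ge 1 i with h1 | h1
    · rw [dθ_eq_zero (show m a < i + (m a - 1) by omega),
        comp_eq_zero (f := v₁) (Or.inr (show m a < i + (m a - 1) by omega)),
        comp_eq_zero (f := v₂) (Or.inr (show m a < i + (m a - 1) by omega))]
      ring
    · have hi1 : i = 1 := by omega
      rw [hi1, show 1 + (m a - 1) = m a by omega, show 1 + 1 = 2 from rfl, heq]
      have hm0 : (m a : ℝ) ≠ 0 := by
        have : 0 < m a := by omega
        positivity
      field_simp
  have r1 := idem_mul_rep (m := m) a (comp v₁ a)
  have r2 := idem_mul_rep (m := m) a (comp v₂ a)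
  rw [Algebra.smul_def] at c1 c2
  simp only [Algebra.smul_def, map_natCast, map_ofNat] at e6
  linear_combination e6 - 2 * repv a v₁ * c1 - 2 * repv a v₂ * c2
    - 2 * (algebraMap ℝ (Alg m) S₁ * nil a ^ (m a - 1)
      - cobound (blockPart (idem a) (bil g₁)) (nil a) (m a)) * r1
    - 2 * (algebraMap ℝ (Alg m) S₂ * nil a ^ (m a - 1)
      - cobound (blockPart (idem a) (bil g₂)) (nil a) (m a)) * r2

/-- The equations within a block in closed form. -/
theorem IsSolutionWithSource.blk_eq (h : IsSolutionWithSource g₁ g₂ v₁ v₂ P)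
    {a : Fin r} (ha : 2 ≤ m a) {n : ℕ} (hn : n ≤ m a) :
    blk P a n = (n : Alg m) * nil a ^ (n - 1) * blk P a 1
      - ((n : Alg m) - 1) * nil a ^ n * blk P a 0
      - 2 * cobound (blockPart (idem a) (bil g₁)) (nil a) n * repv a v₁
      - 2 * cobound (blockPart (idem a) (bil g₂)) (nil a) n * repv a v₂ := by
  rcases Nat.eq_zero_or_pos n with rfl | h1
  · simp [cobound]
  rcases Nat.lt_or_ge n (m a) with hlt | hge
  · exact h.blk_eq_of_lt h1 hlt
  · obtain rfl : n = m a := le_antisymm hn hge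
    have e0 : nil a ^ m a * blk P a 0 = 0 := by
      have e1 := idem_mul_pow_eq_zero (m := m) a le_rfl
      have e2 := idem_mul_rep (m := m) a (fun i => dθ P a (0 + 1) a i)
      rw [blk]
      linear_combination (rep a fun i => dθ P a (0 + 1) a i) * e1 - nil a ^ m a * e2
    rw [blk_eq_zero le_rfl]
    linear_combination -h.blk_last ha + ((m a : Alg m) - 1) * e0

end Conversion

/-! ### Compatibility -/

section Compatibility

open Module

theorem natCast_mul_pow_pred_mul {A : Type*} [CommRing A] (x : A) (n : ℕ) :
    (n : A) * x ^ (n - 1) * x = n * x ^ n := by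
  cases n with
  | zero => simp
  | succ n => rw [Nat.add_sub_cancel, pow_succ]; ring

/-- By `blockPart_deriv` the transverse derivative is the coboundary of `y ↦ e * dΓ (e * y) J e` up
to sign, so the sums telescope. -/
theorem IsFlatJet.cobound_deriv {A : Type*} [CommRing A] [Algebra ℝ A]
    {Γ : A →ₗ[ℝ] A →ₗ[ℝ] A} {dΓ : A →ₗ[ℝ] A →ₗ[ℝ] A →ₗ[ℝ] A}
    (h : IsFlatJet Γ dΓ) {e : A} (he : e * e = e) {J : A} (hJ : e * J = 0) (x : A) (n : ℕ) :
    cobound (blockPart e (dΓ J)) x n = -(e * dΓ (e * x ^ n) J e)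
      + n * x ^ (n - 1) * (e * dΓ (e * x) J e) - (n - 1) * x ^ n * (e * dΓ (e * 1) J e) := by
  induction n with
  | zero => simp [cobound]
  | succ n ih =>
    have e1 := h.blockPart_deriv he hJ x (x ^ n)
    rw [← pow_succ'] at e1
    rw [cobound, ih, Nat.add_sub_cancel, mul_one]
    push_cast
    linear_combination (e * dΓ (e * x) J e) * natCast_mul_pow_pred_mul x n - e1

/-- Two families of solutions of the equations in closed form differ by a term that is determined
by the differences in the free directions. -/
theorem mixed_difference {A : Type*} [CommRing A] {x : A} {t : A} {F P : ℕ → A}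
    {C Q : ℕ → ℕ → A} {N : ℕ}
    (hP : ∀ k ≤ N, P k = k * x ^ (k - 1) * P 1 - (k - 1) * x ^ k * P 0 - 2 * F k * t)
    (hQ : ∀ j ≤ N, ∀ k ≤ N, Q j k = k * x ^ (k - 1) * Q j 1 - (k - 1) * x ^ k * Q j 0
      - 2 * F k * P j - 2 * C j k * t)
    (hC : ∀ a b, C a b - a * x ^ (a - 1) * C 1 b + (a - 1) * x ^ a * C 0 b
      = C b a - b * x ^ (b - 1) * C 1 a + (b - 1) * x ^ b * C 0 a)
    (h0 : ∀ j ≤ N, Q j 0 = Q 0 j) (hN : 1 ≤ N) {j k : ℕ} (hj : j ≤ N) (hk : k ≤ N) :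
    Q j k - Q k j = k * x ^ (k - 1) * (Q j 1 - Q 1 j) - j * x ^ (j - 1) * (Q k 1 - Q 1 k) := by
  have e1 := hQ j hj k hk
  have e2 := hQ k hk j hj
  have e3 := hQ 1 hN j hj
  have e4 := hQ 1 hN k hk
  have e5 := hQ 0 (by omega) j hj
  have e6 := hQ 0 (by omega) k hk
  rw [← h0 j hj] at e5
  rw [← h0 k hk] at e6
  have h10 := h0 1 hN
  have p1 := hP j hj
  have p2 := hP k hk
  have c := hC j k
  rw [e5, p1] at e1
  rw [e6, p2] at e2
  rw [h10] at e3 e4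
  rw [e1, e2, e3, e4]
  linear_combination (-2 * t) * c

variable {r : ℕ} {m : Fin r → ℕ}

/-- A covector supported at the last position of a block vanishes if its product with the top power
of the nilpotent generator does. -/
theorem rep_eq_zero_of_nil_pow {a : Fin r} (ha : 1 ≤ m a) {f : ℕ → ℝ} (hf : ∀ i, m a < i → f i = 0)
    (hl : ∀ i, 1 ≤ i → i < m a → f i = 0)
    (h : (m a : Alg m) * nil a ^ (m a - 1) * rep a f = 0) : (rep a f : Alg m) = 0 := by
  have e : (rep a ((m a : ℝ) • fun i => f (i + (m a - 1))) : Alg m) = 0 := by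
    rw [map_smul, ← nil_pow_mul_rep hf, Algebra.smul_def, map_natCast, ← mul_assoc, h]
  have e1 := eq_zero_of_rep e le_rfl ha
  have hm0 : (m a : ℝ) ≠ 0 := by positivity
  rw [Pi.smul_apply, smul_eq_mul, show 1 + (m a - 1) = m a by omega] at e1
  have e2 := (mul_eq_zero.1 e1).resolve_left hm0
  rw [← map_zero (rep a)]
  refine rep_congr fun i h1 hi => ?_
  rcases Nat.lt_or_ge i (m a) with hlt | hge
  · exact hl i h1 hlt
  · rw [show i = m a by omega, e2]; rfl

theorem repv_sub_eq (a : Fin r) (w w' : BIdx m → ℝ) :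
    repv a w - repv a w' = rep a fun i => comp (fun I => w I - w' I) a i := by
  rw [← map_sub]
  refine rep_congr fun i _ _ => ?_
  rw [Pi.sub_apply]
  unfold comp
  split_ifs <;> simp

theorem comp_of_mem {f : BIdx m → ℝ} {a : Fin r} {i : ℕ} (h : i ∈ Finset.Icc 1 (m a)) :
    comp f a i = f ⟨a, i, h⟩ := comp_mk f a ⟨i, h⟩

theorem rhsAt_zero (g : Tup m) (J I : BIdx m) : rhsAt g J I 0 0 = 0 := by
  have h : ∀ a i, comp (0 : BIdx m → ℝ) a i = 0 := by
    intro a i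
    simp [comp]
  simp [rhsAt, rhs, h, dθ_zero]

theorem repv_zero (a : Fin r) : (repv a 0 : Alg m) = 0 := by
  rw [← map_zero (rep a)]
  refine rep_congr fun i _ _ => ?_
  simp [comp]

/-- The jet of the connection at a point with the second-order jet of a solution of the system. -/
structure IsSolutionJet (g : Tup m) (dΓ : Alg m →ₗ[ℝ] Alg m →ₗ[ℝ] Alg m →ₗ[ℝ] Alg m)
    (v : BIdx m → ℝ) (p : BIdx m → BIdx m → ℝ) (q : BIdx m → BIdx m → BIdx m → ℝ) : Prop where
  pos : ∀ a, 1 ≤ m a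
  jet : IsFlatJet (bil g) dΓ
  first : IsSolutionWithSource g g v 0 p
  second : ∀ K, ∃ g' : Tup m, bil g' = dΓ (bas K) ∧ IsSolutionWithSource g g' (p K) v (q K)
  symm : ∀ K J I, ¬ (Prescribed J I ∧ Prescribed K I) → q K J I = q J K I

variable {g : Tup m} {dΓ : Alg m →ₗ[ℝ] Alg m →ₗ[ℝ] Alg m →ₗ[ℝ] Alg m} {v : BIdx m → ℝ}
  {p : BIdx m → BIdx m → ℝ} {q : BIdx m → BIdx m → BIdx m → ℝ}

namespace IsSolutionJet

theorem first_transverse (h : IsSolutionJet g dΓ v p q) {a : Fin r} {J : BIdx m} (hJ : J.1 ≠ a) :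
    repv a (p J) = 2 * bil g (bas J) (idem a) * repv a v := by
  rw [h.first.transverse hJ, repv_zero, mul_zero, add_zero]

theorem first_blk (h : IsSolutionJet g dΓ v p q) {a : Fin r} (ha : 2 ≤ m a) {n : ℕ} (hn : n ≤ m a) :
    blk p a n = (n : Alg m) * nil a ^ (n - 1) * blk p a 1
      - ((n : Alg m) - 1) * nil a ^ n * blk p a 0
      - 2 * cobound (blockPart (idem a) (bil g)) (nil a) n * repv a v := by
  rw [h.first.blk_eq ha hn, repv_zero, mul_zero, sub_zero]

theorem second_transverse (h : IsSolutionJet g dΓ v p q) {a : Fin r} (K : BIdx m) {J : BIdx m}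
    (hJ : J.1 ≠ a) : repv a (q K J) = 2 * bil g (bas J) (idem a) * repv a (p K)
      + 2 * dΓ (bas K) (bas J) (idem a) * repv a v := by
  obtain ⟨g', hg, hs⟩ := h.second K
  rw [hs.transverse hJ, hg]

theorem second_blk (h : IsSolutionJet g dΓ v p q) {a : Fin r} (ha : 2 ≤ m a) (K : BIdx m) {n : ℕ}
    (hn : n ≤ m a) : blk (q K) a n = (n : Alg m) * nil a ^ (n - 1) * blk (q K) a 1
      - ((n : Alg m) - 1) * nil a ^ n * blk (q K) a 0
      - 2 * cobound (blockPart (idem a) (bil g)) (nil a) n * repv a (p K)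
      - 2 * cobound (blockPart (idem a) (dΓ (bas K))) (nil a) n * repv a v := by
  obtain ⟨g', hg, hs⟩ := h.second K
  rw [hs.blk_eq ha hn, hg]

/-- Two directions outside the block. -/
theorem comm_transverse (h : IsSolutionJet g dΓ v p q) {a : Fin r} {J K : BIdx m} (hJ : J.1 ≠ a)
    (hK : K.1 ≠ a) : repv a (q J K) = repv a (q K J) := by
  rw [h.second_transverse J hK, h.second_transverse K hJ, h.first_transverse hJ,
    h.first_transverse hK]
  have e := h.jet.deriv_transverse (idem_mul_self a) (idem_mul_bas_of_ne hJ) (idem_mul_bas_of_ne hK)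
  have e1 := idem_mul_rep (m := m) a (comp v a)
  linear_combination 2 * repv a v * e
    - 2 * (dΓ (bas J) (bas K) (idem a) - dΓ (bas K) (bas J) (idem a)) * e1

/-- One direction in the block and one outside. -/
theorem comm_mixed (h : IsSolutionJet g dΓ v p q) {a : Fin r} (ha : 2 ≤ m a) {K : BIdx m}
    (hK : K.1 ≠ a) {n : ℕ} (hn : n + 1 ∈ Finset.Icc 1 (m a)) :
    repv a (q K ⟨a, n + 1, hn⟩) = repv a (q ⟨a, n + 1, hn⟩ K) := by
  set e : Alg m := idem a with he
  set G : Alg m := bil g (bas K) e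
  -- `T n` is the iterated derivative in the other order, extended to `n = m a`, where it vanishes.
  set T : ℕ → Alg m := fun n => 2 * G * blk p a n
    + 2 * (e * dΓ (e * nil a ^ n) (bas K) e) * repv a v with hT
  have hTr : ∀ n (hn : n + 1 ∈ Finset.Icc 1 (m a)), T n = repv a (q ⟨a, n + 1, hn⟩ K) := by
    intro n hn
    rw [h.second_transverse _ hK, bas_mk, ← blk_eq_repv hn]
    simp only [hT]
    linear_combination 2 * dΓ (e * nil a ^ n) (bas K) e * idem_mul_rep (m := m) a (comp v a)
  have hT0 : T (m a) = 0 := by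
    simp only [hT]
    rw [blk_eq_zero le_rfl, he, idem_mul_pow_eq_zero a le_rfl]
    simp
  have hA : ∀ n (hn : n + 1 ∈ Finset.Icc 1 (m a)), blk (q K) a n - T n = rep a fun i =>
      comp (fun I => q K ⟨a, n + 1, hn⟩ I - q ⟨a, n + 1, hn⟩ K I) a i := by
    intro n hn
    rw [hTr n hn, blk_eq_repv hn, repv_sub_eq]
  have hform : ∀ n ≤ m a, blk (q K) a n - T n
      = (n : Alg m) * nil a ^ (n - 1) * (blk (q K) a 1 - T 1)
        - ((n : Alg m) - 1) * nil a ^ n * (blk (q K) a 0 - T 0) := by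
    intro n hn
    have e1 := h.second_blk ha K hn
    have e2 := h.first_blk ha hn
    have e3 := h.jet.cobound_deriv (idem_mul_self a) (idem_mul_bas_of_ne hK) (nil a) n
    rw [h.first_transverse hK, e3] at e1
    simp only [hT, pow_one, pow_zero]
    rw [e1, e2]
    ring
  have m1 : 0 + 1 ∈ Finset.Icc 1 (m a) := by rw [Finset.mem_Icc]; omega
  have m2 : 1 + 1 ∈ Finset.Icc 1 (m a) := by rw [Finset.mem_Icc]; omega
  have h0 : blk (q K) a 0 - T 0 = 0 := by
    rw [hA 0 m1, ← map_zero (rep a)]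
    refine rep_congr fun i h1 hi => ?_
    rw [comp_of_mem (Finset.mem_Icc.2 ⟨h1, hi⟩), h.symm K _ _ (by simp [Prescribed]), sub_self]
    rfl
  -- At `n = m a` the closed form leaves `m ε^(m-1)` times this difference. Below the last position
  -- `∂_2 θ` is free, so the difference sits at the last position alone and must vanish.
  have h1 : blk (q K) a 1 - T 1 = 0 := by
    have e1 := hform (m a) le_rfl
    rw [h0, hT0, blk_eq_zero le_rfl, mul_zero, sub_zero, sub_zero] at e1
    rw [hA 1 m2] at e1 ⊢
    refine rep_eq_zero_of_nil_pow (h.pos a) (fun i hi => comp_eq_zero (Or.inr hi)) ?_ e1.symm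
    intro i h1 hi
    rw [comp_of_mem (Finset.mem_Icc.2 ⟨h1, hi.le⟩), h.symm K _ _ (by simp [Prescribed]; omega),
      sub_self]
  have e1 := hform n (by rw [Finset.mem_Icc] at hn; omega)
  rw [h0, h1, mul_zero, mul_zero, sub_zero, hTr n hn, blk_eq_repv hn] at e1
  exact sub_eq_zero.1 e1

/-- Two directions in the block. -/
theorem comm_block (h : IsSolutionJet g dΓ v p q) {a : Fin r} (ha : 2 ≤ m a) {j k : ℕ}
    (hj : j + 1 ∈ Finset.Icc 1 (m a)) (hk : k + 1 ∈ Finset.Icc 1 (m a)) :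
    repv a (q ⟨a, j + 1, hj⟩ ⟨a, k + 1, hk⟩) = repv a (q ⟨a, k + 1, hk⟩ ⟨a, j + 1, hj⟩) := by
  -- The value `0` off the block makes the closed form hold for `j = m a` too, where `idem a * nil a
  -- ^ j = 0`.
  set Q : ℕ → ℕ → Alg m := fun j k =>
    if hj : j + 1 ∈ Finset.Icc 1 (m a) then blk (q ⟨a, j + 1, hj⟩) a k else 0 with hQ
  have hQ1 : ∀ j k (hj : j + 1 ∈ Finset.Icc 1 (m a)) (hk : k + 1 ∈ Finset.Icc 1 (m a)),
      Q j k = repv a (q ⟨a, j + 1, hj⟩ ⟨a, k + 1, hk⟩) := by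
    intro j k hj hk
    simp only [hQ]
    rw [dif_pos hj, blk_eq_repv hk]
  have hA : ∀ j k (hj : j + 1 ∈ Finset.Icc 1 (m a)) (hk : k + 1 ∈ Finset.Icc 1 (m a)),
      Q j k - Q k j = rep a fun i => comp (fun I => q ⟨a, j + 1, hj⟩ ⟨a, k + 1, hk⟩ I
        - q ⟨a, k + 1, hk⟩ ⟨a, j + 1, hj⟩ I) a i := by
    intro j k hj hk
    rw [hQ1 j k hj hk, hQ1 k j hk hj, repv_sub_eq]
  have hQr : ∀ j, Q j (m a) = 0 := by
    intro j
    simp only [hQ]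
    split_ifs
    · exact blk_eq_zero le_rfl
    · rfl
  have hQl : ∀ k, Q (m a) k = 0 := by
    intro k
    simp only [hQ]
    rw [dif_neg]
    rw [Finset.mem_Icc]; omega
  have m1 : 0 + 1 ∈ Finset.Icc 1 (m a) := by rw [Finset.mem_Icc]; omega
  have m2 : 1 + 1 ∈ Finset.Icc 1 (m a) := by rw [Finset.mem_Icc]; omega
  have hQ0 : ∀ j ≤ m a, Q j 0 = Q 0 j := by
    intro j hj
    rcases Nat.lt_or_ge j (m a) with hlt | hge
    · have mj : j + 1 ∈ Finset.Icc 1 (m a) := by rw [Finset.mem_Icc]; omega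
      rw [← sub_eq_zero, hA j 0 mj m1, ← map_zero (rep a)]
      refine rep_congr fun i h1 hi => ?_
      rw [comp_of_mem (Finset.mem_Icc.2 ⟨h1, hi⟩), h.symm _ _ _ (by simp [Prescribed]), sub_self]
      rfl
    · rw [show j = m a by omega, hQl, hQr]
  have hd := cobound_deriv_symm (A := Alg m) (dH := fun x => blockPart (idem a) (dΓ (idem a * x)))
    (h.jet.norm.blockPart (idem_mul_self a)).cocycle (h.jet.norm.blockPart (idem_mul_self a)).symm
    (h.jet.norm.blockPart (idem_mul_self a)).unit
    (fun x => ((h.jet.dnorm _).blockPart (idem_mul_self a)).cocycle)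
    (fun x => ((h.jet.dnorm _).blockPart (idem_mul_self a)).symm)
    (fun x => ((h.jet.dnorm _).blockPart (idem_mul_self a)).unit)
    (fun x y z => h.jet.blockPart_flat (idem_mul_self a) x y z) (nil a)
  have key := fun (j k : ℕ) (hj : j ≤ m a) (hk : k ≤ m a) =>
    mixed_difference (x := nil a) (t := repv a v) (P := blk p a) (Q := Q) (N := m a)
      (F := cobound (blockPart (idem a) (bil g)) (nil a))
      (C := fun j => cobound (blockPart (idem a) (dΓ (idem a * nil a ^ j))) (nil a))
      (fun k hk => h.first_blk ha hk)
      (fun j hj k hk => by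
        rcases Nat.lt_or_ge j (m a) with hlt | hge
        · have mj : j + 1 ∈ Finset.Icc 1 (m a) := by rw [Finset.mem_Icc]; omega
          have e1 := h.second_blk ha ⟨a, j + 1, mj⟩ hk
          rw [bas_mk, ← blk_eq_repv mj] at e1
          simp only [hQ]
          simp only [dif_pos mj]
          exact e1
        · obtain rfl : j = m a := le_antisymm hj hge
          have e2 : blockPart (idem a) (0 : Alg m →ₗ[ℝ] Alg m →ₗ[ℝ] Alg m) = 0 := by
            ext x y
            simp [blockPart_apply]
          rw [hQl, hQl, hQl, blk_eq_zero le_rfl]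
          simp only [idem_mul_pow_eq_zero (m := m) a le_rfl, map_zero, e2, cobound_zero_left]
          ring)
      (fun j k => by
        have := hd j k
        simpa only [pow_zero, pow_one] using this)
      hQ0 (h.pos a) hj hk
  -- Taking `k = m a` in `key` again leaves only `m ε^(m-1)` times the commutator with `∂_2`.
  have h1 : ∀ j ≤ m a, Q j 1 - Q 1 j = 0 := by
    intro j hj
    rcases Nat.lt_or_ge j (m a) with hlt | hge
    · have mj : j + 1 ∈ Finset.Icc 1 (m a) := by rw [Finset.mem_Icc]; omega
      have e1 := key j (m a) hj le_rfl
      rw [hQl, hQl, hQr, hQr, sub_zero, mul_zero, sub_zero] at e1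
      rw [hA j 1 mj m2] at e1 ⊢
      refine rep_eq_zero_of_nil_pow (h.pos a) (fun i hi => comp_eq_zero (Or.inr hi)) ?_ e1.symm
      intro i h1 hi
      rw [comp_of_mem (Finset.mem_Icc.2 ⟨h1, hi.le⟩), h.symm _ _ _ (by simp [Prescribed]; omega),
        sub_self]
    · rw [show j = m a by omega, hQl, hQr, sub_zero]
  have e1 := key j k (by rw [Finset.mem_Icc] at hj; omega) (by rw [Finset.mem_Icc] at hk; omega)
  rw [h1 j (by rw [Finset.mem_Icc] at hj; omega), h1 k (by rw [Finset.mem_Icc] at hk; omega),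
    mul_zero, mul_zero, sub_zero, hQ1 j k hj hk, hQ1 k j hk hj] at e1
  exact sub_eq_zero.1 e1

theorem comm (h : IsSolutionJet g dΓ v p q) {J K I : BIdx m} (hJ : Prescribed J I)
    (hK : Prescribed K I) : q J K I = q K J I := by
  have hpos := h.pos I.1
  have hrep : repv I.1 (q J K) = repv I.1 (q K J) := by
    obtain ⟨b, j, hj⟩ := J
    obtain ⟨c, k, hk⟩ := K
    obtain ⟨a, i, hi⟩ := I
    have hj' := Finset.mem_Icc.1 hj
    have hk' := Finset.mem_Icc.1 hk
    have hi' := Finset.mem_Icc.1 hi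
    obtain ⟨j, rfl⟩ := Nat.exists_eq_add_of_le' hj'.1
    obtain ⟨k, rfl⟩ := Nat.exists_eq_add_of_le' hk'.1
    simp only [Prescribed] at hJ hK
    by_cases hb : b = a
    · subst hb
      -- A derivative prescribed within its own block has position at least two.
      have ha : 2 ≤ m b := by omega
      by_cases hc : c = b
      · subst hc
        exact h.comm_block ha hj hk
      · exact (h.comm_mixed ha (by exact hc) hj).symm
    · by_cases hc : c = a
      · subst hc
        have ha : 2 ≤ m c := by omega
        exact h.comm_mixed ha (by exact hb) hk
      · exact h.comm_transverse hb hc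
  have e1 := sub_eq_zero.2 hrep
  rw [repv_sub_eq] at e1
  have hi := Finset.mem_Icc.1 I.2.2
  have e2 := eq_zero_of_rep e1 hi.1 hi.2
  rw [comp_mk] at e2
  exact sub_eq_zero.1 e2

end IsSolutionJet

theorem IsDarbouxTsarev.isSolutionJet {U : Set (Pt m)} {X : BIdx m → Pt m → ℝ}
    {Γ : BIdx m → BIdx m → BIdx m → Pt m → ℝ} (h : IsDarbouxTsarev U X Γ) (hm : ∀ a, 1 ≤ m a)
    (hU : IsOpen U) {u : Pt m} (hu : u ∈ U) (hs : IsFormalSolution Prescribed (rhs Γ) u v p q) :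
    IsSolutionJet (fun I J K => Γ I J K u) (dbil Γ u) v p q where
  pos := hm
  jet := h.isFlatJet hm hU hu
  first :=
    { filt₁ := h.bil_filtered hm hU hu
      filt₂ := h.bil_filtered hm hU hu
      norm₁ := h.bil_normalized hm hU hu
      norm₂ := h.bil_normalized hm hU hu
      eqn := fun J I hJ => by
        rw [rhsAt_zero, add_zero]
        exact hs.eqn J I hJ }
  second := fun K => ⟨fun I J L => pd K (Γ I J L) u, (dbil_bas u K).symm,
    { filt₁ := h.bil_filtered hm hU hu
      filt₂ := dbil_bas (Γ := Γ) u K ▸ h.dbil_filtered hm hU hu (bas K)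
      norm₁ := h.bil_normalized hm hU hu
      norm₂ := dbil_bas (Γ := Γ) u K ▸ (h.isFlatJet hm hU hu).dnorm (bas K)
      eqn := fun J I hJ => by
        rw [hs.deriv_eqn K J I hJ, totalDeriv_rhs]
        intro I J L
        exact ((h.smooth_Γ I J L).contDiffAt (hU.mem_nhds hu)).differentiableAt (by simp) }⟩
  symm := hs.symm

end Compatibility

end DT

end

/-- For a hydrodynamic system of Darboux–Tsarev type the system for `θ` is compatible. -/
theorem mainTheorem3 {r : ℕ} (m : Fin r → ℕ) (hm : ∀ a, 1 ≤ m a)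
    (U : Set (DT.Pt m)) (hU : IsOpen U)
    (X : DT.BIdx m → DT.Pt m → ℝ)
    (Γ : DT.BIdx m → DT.BIdx m → DT.BIdx m → DT.Pt m → ℝ)
    (hDT : DT.IsDarbouxTsarev U X Γ) :
    DT.IsCompatible U DT.Prescribed (DT.rhs Γ) := by
  intro u hu v p q hs J K I hJ hK
  exact sub_eq_zero.2 ((hDT.isSolutionJet hm hU hu hs).comm hJ hK)
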